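/- Let $p$ (in-distribution) and $q$ (OOD) be probability distributions on $\mathbb{R}^n$ with finite second moments. For a noise level $s>0$ let $x_s = x + s z$ with $z\sim\mathcal N(0,I)$ independent of $x$, and let $p_s$ and $q_s$ be the law of $x_s$ when $x\sim p$ and when $x\sim q$ respectively. Let $D_p(x_s)=\mathbb{E}_p[x\mid x_s]$ and $D_q(x_s)=\mathbb{E}_q[x\mid x_s]$ be the MMSE denoisers at noise level $s$. For a denoiser $D$ put $\mathrm{MSE}(D,s)=\mathbb{E}\big[\|x-D(x_s)\|_2^2\big]$, where $x\sim p$. Then, for every $s>0$, both errors are finite and $\mathrm{MSE}(D_p,s)\le \mathrm{MSE}(D_q,s)$. Moreover, as an identity in $[0,\infty]$, $$\mathrm{D_{KL}}(p\,\|\,q)=\int_0^\infty\big[\mathrm{MSE}(D_q,t)-\mathrm{MSE}(D_p,t)\big]\,t^{-3}\,dt ,$$ that is, the accumulated excess denoising error weighted by $\sigma_t^{-3}$, where time is the noise level, $\sigma_t=t$. More generally, let $T\in(0,\infty]$ and let $t\mapsto\sigma_t$ be a positive, nondecreasing, differentiable noise schedule on $(0,T)$ with $\sigma_t\to0$ as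 $t\to0^+$. Then for every finite $S\in(0,T)$, again in $[0,\infty]$, $$\mathrm{D_{KL}}(p\,\|\,q)=\mathrm{D_{KL}}(p_{\sigma_S}\,\|\,q_{\sigma_S})+\int_0^S\big[\mathrm{MSE}(D_q,\sigma_t)-\mathrm{MSE}(D_p,\sigma_t)\big]\,\sigma_t^{-3}\,\dot\sigma_t\,dt ,$$ and if $\sigma_t$ is unbounded on $(0,T)$, then $$\mathrm{D_{KL}}(p\,\|\,q)=\int_0^T\big[\mathrm{MSE}(D_q,\sigma_t)-\mathrm{MSE}(D_p,\sigma_t)\big]\,\sigma_t^{-3}\,\dot\sigma_t\,dt .$$ -/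

import Mathlib

open MeasureTheory ProbabilityTheory InformationTheory Set Filter Topology
open scoped ENNReal

namespace Denoising

/-- The joint law of `(x, x_s)`, where `x ∼ p`, `x_s = x + s z` and `z ∼ N(0, I)` is
independent of `x`; thus `x_s ∼ N(x, s² I)` given `x`. -/
noncomputable def noisyPair {n : ℕ} (p : Measure (EuclideanSpace ℝ (Fin n))) (s : ℝ) :
    Measure (EuclideanSpace ℝ (Fin n) × EuclideanSpace ℝ (Fin n)) :=
  (p.prod (stdGaussian (EuclideanSpace ℝ (Fin n)))).map fun w => (w.1, w.1 + s • w.2)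

instance isProbabilityMeasure_noisyPair {n : ℕ} (p : Measure (EuclideanSpace ℝ (Fin n)))
    [IsProbabilityMeasure p] (s : ℝ) : IsProbabilityMeasure (noisyPair p s) :=
  Measure.isProbabilityMeasure_map (Measurable.aemeasurable (by fun_prop))

/-- The noisy marginal `p_s`, i.e. the law of `x_s`. -/
noncomputable def noisyMarginal {n : ℕ} (p : Measure (EuclideanSpace ℝ (Fin n))) (s : ℝ) :
    Measure (EuclideanSpace ℝ (Fin n)) :=
  (noisyPair p s).snd

/-- The MMSE denoiser `D_q(y) = 𝔼_q[x | x_s = y]`: the mean of the conditional law of `x`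
given `x_s = y`, where `x ∼ q`. -/
noncomputable def denoiser {n : ℕ} (q : Measure (EuclideanSpace ℝ (Fin n)))
    [IsProbabilityMeasure q] (s : ℝ) (y : EuclideanSpace ℝ (Fin n)) :
    EuclideanSpace ℝ (Fin n) :=
  ∫ x, x ∂(condDistrib Prod.fst Prod.snd (noisyPair q s) y)

/-- The mean squared error `𝔼 ‖x - D(x_s)‖²` of a denoiser `D`, where `x ∼ p`. -/
noncomputable def mse {n : ℕ} (p : Measure (EuclideanSpace ℝ (Fin n))) (s : ℝ)
    (D : EuclideanSpace ℝ (Fin n) → EuclideanSpace ℝ (Fin n)) : ℝ :=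
  ∫ w, ‖w.1 - D w.2‖ ^ 2 ∂(noisyPair p s)

/-- The excess denoising error `MSE(D_q) - MSE(D_p)` at noise level `s`, on data from `p`. -/
noncomputable def excessError {n : ℕ} (p q : Measure (EuclideanSpace ℝ (Fin n)))
    [IsProbabilityMeasure p] [IsProbabilityMeasure q] (s : ℝ) : ℝ :=
  mse p s (denoiser q s) - mse p s (denoiser p s)

/-- The times `t` with `0 < t < T`, for a horizon `T` that may be infinite. -/
def times (T : EReal) : Set ℝ := {t : ℝ | 0 < t ∧ (t : EReal) < T}

/-- A noise schedule `t ↦ σ_t` on `(0, T)`: positive, nondecreasing and differentiable, and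
without noise at time `0`. -/
structure IsNoiseSchedule (T : EReal) (σ : ℝ → ℝ) : Prop where
  pos : ∀ t ∈ times T, 0 < σ t
  monotoneOn : MonotoneOn σ (times T)
  differentiableAt : ∀ t ∈ times T, DifferentiableAt ℝ σ t
  tendsto_zero : Tendsto σ (𝓝[>] 0) (𝓝 0)

end Denoising

/-!
# Divergence as accumulated excess denoising error

Put `r = 1 / s`. The observation `y = x + s z` is equivalent to `a = r x + z`, whose density under
the model `q` is, up to a factor that does not depend on `q`, the likelihood
`L_q(r, a) = ∫ exp(-‖a - r v‖² / 2) dq(v)`; the denoiser is the mean of the posterior, which is the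
measure `q` tilted by the same exponential. Hence the divergence of the noisy laws is
`𝔼 log L_p(r, r x + z) - 𝔼 log L_q(r, r x + z)` with `x ∼ p` (`klDiv_noisyMarginal`).

The heart of the proof is the mismatched I-MMSE relation `hasDerivAt_expectedLogLikelihood`:
`d/dr 𝔼 log L_q(r, r x + z) = -r MSE(D_q, 1/r)`. At fixed `x` and `z` the derivative of the
log-likelihood is, with `v` drawn from the posterior,
`-𝔼 ⟪r (x - v) + z, x - v⟫ = -r 𝔼 ‖x - v‖² - ⟪z, x - 𝔼 v⟫`. Stein's lemma in `z` turns the last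
term into `r` times the total posterior variance, which cancels the variance part of the first term
and leaves `-r ‖x - 𝔼 v‖²`. All dominations come from one inequality, `integral_sq_posterior_le`:
the posterior mean of `‖a - r v‖²` is at most its mean under `q`, because the tilting favours small
values of this very quantity. Only second moments are used.

In the noise level, the divergence `J(s)` of the noisy laws therefore has the derivative
`-(MSE(D_q, s) - MSE(D_p, s)) s⁻³`, which has a sign, so that the fundamental theorem of calculus
applies to `J ∘ σ` for every schedule without integrability assumptions
(`ofReal_comp_schedule_eq`). It remains to identify the limits of `J`. At infinite noise `J` tends
to `0`, since `L_q(0, z)` does not depend on `q`. At zero noise `J` tends to the divergence of `p`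
and `q`, also if this is infinite: data processing gives one inequality, and the other is lower
semicontinuity (`klDiv_le_of_eventually_noisyMarginal_le`), which follows from the dual description
of the divergence by bounded continuous functions.
-/

set_option linter.unusedSectionVars false

namespace Denoising

open scoped RealInnerProductSpace

/-! ### The Gaussian density and Stein's lemma -/

section GaussianDensity

variable {E : Type*} [NormedAddCommGroup E] [InnerProductSpace ℝ E] [FiniteDimensional ℝ E]
  [MeasurableSpace E] [BorelSpace E]

/-- The density of the standard Gaussian measure with respect to Lebesgue measure. -/
noncomputable def gaussianDensity (z : E) : ℝ :=
  (2 * Real.pi) ^ (-(Module.finrank ℝ E / 2 : ℝ)) * Real.exp (-‖z‖ ^ 2 / 2)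

lemma gaussianDensity_pos (z : E) : 0 < gaussianDensity z := by
  unfold gaussianDensity; positivity

lemma continuous_gaussianDensity : Continuous (gaussianDensity (E := E)) := by
  unfold gaussianDensity; fun_prop

lemma integrable_gaussianDensity : Integrable (gaussianDensity (E := E)) := by
  refine Integrable.const_mul ?_ _
  have h := (GaussianFourier.integrable_cexp_neg_mul_sq_norm_add (V := E) (b := 1 / 2)
    (by norm_num) 0 0).norm
  refine h.congr (ae_of_all _ fun z => ?_)
  simp only [Complex.norm_exp]
  congr 1
  simp [← Complex.ofReal_pow]
  ring

lemma stdGaussian_eq_withDensity :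
    stdGaussian E = volume.withDensity fun z => ENNReal.ofReal (gaussianDensity z) := by
  have : IsFiniteMeasure (volume.withDensity fun z : E => ENNReal.ofReal (gaussianDensity z)) :=
    isFiniteMeasure_withDensity_ofReal integrable_gaussianDensity.2
  refine Measure.ext_of_charFun (funext fun t => ?_)
  rw [charFun_stdGaussian, charFun_apply, integral_withDensity_eq_integral_toReal_smul
    (continuous_gaussianDensity.measurable.ennreal_ofReal) (ae_of_all _ fun _ => by simp)]
  have h := GaussianFourier.integral_cexp_neg_mul_sq_norm_add (V := E) (b := 1 / 2)
    (by norm_num) Complex.I t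
  have hc : ((Real.pi : ℂ) / (1 / 2)) ^ (Module.finrank ℝ E / 2 : ℂ) =
      (((2 * Real.pi) ^ (Module.finrank ℝ E / 2 : ℝ) : ℝ) : ℂ) := by
    rw [Complex.ofReal_cpow (by positivity)]
    push_cast
    congr 1
    ring
  have h2 : ∀ z : E, (ENNReal.ofReal (gaussianDensity z)).toReal •
      Complex.exp (⟪z, t⟫ * Complex.I) = (((2 * Real.pi) ^ (-(Module.finrank ℝ E / 2 : ℝ)) : ℝ) : ℂ)
        * Complex.exp (-(1 / 2) * ‖z‖ ^ 2 + Complex.I * ⟪t, z⟫) := by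
    intro z
    rw [ENNReal.toReal_ofReal (gaussianDensity_pos z).le, gaussianDensity, Complex.real_smul,
      Complex.ofReal_mul, mul_assoc, Complex.ofReal_exp, ← Complex.exp_add, real_inner_comm]
    congr 2
    push_cast
    ring
  simp_rw [h2]
  rw [integral_const_mul, h, hc, ← mul_assoc, ← Complex.ofReal_mul,
    Real.rpow_neg (by positivity), inv_mul_cancel₀ (by positivity), Complex.I_sq]
  simp
  ring_nf

lemma integral_stdGaussian {F : Type*} [NormedAddCommGroup F] [NormedSpace ℝ F] (f : E → F) :
    ∫ z, f z ∂(stdGaussian E) = ∫ z, gaussianDensity z • f z := by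
  rw [stdGaussian_eq_withDensity, integral_withDensity_eq_integral_toReal_smul
    (continuous_gaussianDensity.measurable.ennreal_ofReal) (ae_of_all _ fun _ => by simp)]
  simp [ENNReal.toReal_ofReal (gaussianDensity_pos _).le]

lemma integrable_stdGaussian_iff {f : E → ℝ} :
    Integrable f (stdGaussian E) ↔ Integrable fun z => f z * gaussianDensity z := by
  rw [stdGaussian_eq_withDensity, integrable_withDensity_iff
    (continuous_gaussianDensity.measurable.ennreal_ofReal) (ae_of_all _ fun _ => by simp)]
  simp [ENNReal.toReal_ofReal (gaussianDensity_pos _).le]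

/-- **Stein's lemma**: integration by parts against the standard Gaussian measure. -/
lemma integral_inner_mul_stdGaussian {f f' : E → ℝ} (e : E)
    (hf : Integrable f (stdGaussian E)) (hf' : Integrable f' (stdGaussian E))
    (hfe : Integrable (fun z => f z * ⟪z, e⟫) (stdGaussian E))
    (hd : ∀ z, HasLineDerivAt ℝ f (f' z) z e) :
    ∫ z, f z * ⟪z, e⟫ ∂(stdGaussian E) = ∫ z, f' z ∂(stdGaussian E) := by
  have hg : ∀ z : E, HasLineDerivAt ℝ gaussianDensity (-(⟪z, e⟫ * gaussianDensity z)) z e := by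
    intro z
    unfold HasLineDerivAt gaussianDensity
    have h1 : HasDerivAt (fun t : ℝ => z + t • e) e 0 := by
      simpa using ((hasDerivAt_id (0 : ℝ)).smul_const e).const_add z
    have h2 := (((h1.norm_sq.neg.div_const 2).exp).const_mul
      ((2 * Real.pi) ^ (-(Module.finrank ℝ E / 2 : ℝ))))
    refine h2.congr_deriv ?_
    simp
    ring
  have key := integral_bilinear_hasLineDerivAt_right_eq_neg_left_of_integrable (μ := volume)
    (f := f) (f' := f') (g := gaussianDensity) (g' := fun z => -(⟪z, e⟫ * gaussianDensity z))
    (v := e) (B := ContinuousLinearMap.mul ℝ ℝ)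
    (by simpa using integrable_stdGaussian_iff.1 hf')
    (by
      refine (integrable_stdGaussian_iff.1 hfe).neg.congr (ae_of_all _ fun z => ?_)
      simp; ring)
    (by simpa using integrable_stdGaussian_iff.1 hf)
    (fun z _ => hd z) (fun z _ => hg z)
  rw [integral_stdGaussian, integral_stdGaussian]
  simp only [ContinuousLinearMap.mul_apply', mul_neg, integral_neg, neg_inj, smul_eq_mul] at key ⊢
  rw [show (fun z => gaussianDensity z * f' z) = fun z => f' z * gaussianDensity z from
    funext fun z => mul_comm _ _, ← key]
  congr 1
  ext z
  ring

end GaussianDensity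

/-! ### The posterior of a Gaussian channel -/

section Posterior

variable {E : Type*} [NormedAddCommGroup E] [InnerProductSpace ℝ E] [FiniteDimensional ℝ E]
  [MeasurableSpace E] [BorelSpace E]

/-- The unnormalised likelihood `∫ exp(-‖a - r v‖² / 2) dq(v)` of observing `a = r v + z`, where
`v ∼ q` and `z` is standard Gaussian. Here `r` is the inverse `1 / s` of the noise level, and
`a = r y` is the rescaled noisy observation. -/
noncomputable def likelihood (q : Measure E) (r : ℝ) (a : E) : ℝ :=
  ∫ v, Real.exp (-‖a - r • v‖ ^ 2 / 2) ∂q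

/-- The conditional law of `v ∼ q` given `r v + z = a`, where `z` is standard Gaussian. -/
noncomputable def posterior (q : Measure E) (r : ℝ) (a : E) : Measure E :=
  q.tilted fun v => -‖a - r • v‖ ^ 2 / 2

/-- The mean of `posterior q r a`. -/
noncomputable def posteriorMean (q : Measure E) (r : ℝ) (a : E) : E :=
  ∫ v, v ∂(posterior q r a)

variable {q : Measure E} [IsProbabilityMeasure q]

lemma exp_neg_sq_le_one (w : E) : Real.exp (-‖w‖ ^ 2 / 2) ≤ 1 :=
  Real.exp_le_one_iff.2 (by nlinarith [sq_nonneg ‖w‖])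

lemma integrable_exp_mul {α : Type*} {m : MeasurableSpace α} {μ : Measure α} {g : α → ℝ}
    (hg : Integrable g μ) {w : α → E} (hw : AEStronglyMeasurable w μ) :
    Integrable (fun v => Real.exp (-‖w v‖ ^ 2 / 2) * g v) μ := by
  refine hg.bdd_mul (c := 1) ?_ (ae_of_all _ fun v => ?_)
  · exact ((Real.continuous_exp.comp (((continuous_norm.pow 2).neg).div_const
      2)).comp_aestronglyMeasurable hw)
  · rw [Real.norm_eq_abs, abs_of_pos (Real.exp_pos _)]
    exact exp_neg_sq_le_one _

lemma integrable_exp_sq (r : ℝ) (a : E) :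
    Integrable (fun v => Real.exp (-‖a - r • v‖ ^ 2 / 2)) q := by
  simpa using integrable_exp_mul (μ := q) (integrable_const (1 : ℝ))
    (w := fun v => a - r • v) (by fun_prop)

lemma likelihood_pos (r : ℝ) (a : E) : 0 < likelihood q r a :=
  integral_exp_pos (integrable_exp_sq r a)

instance isProbabilityMeasure_posterior (r : ℝ) (a : E) :
    IsProbabilityMeasure (posterior q r a) :=
  isProbabilityMeasure_tilted (integrable_exp_sq r a)

lemma integral_posterior {F : Type*} [NormedAddCommGroup F] [NormedSpace ℝ F] (r : ℝ) (a : E)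
    (g : E → F) : ∫ v, g v ∂(posterior q r a) =
      (likelihood q r a)⁻¹ • ∫ v, Real.exp (-‖a - r • v‖ ^ 2 / 2) • g v ∂q := by
  rw [posterior, integral_tilted, ← integral_smul]
  congr 1
  ext v
  rw [smul_smul, div_eq_inv_mul]
  rfl

lemma integrable_posterior {F : Type*} [NormedAddCommGroup F] [NormedSpace ℝ F] {g : E → F}
    (hg : Integrable g q) (r : ℝ) (a : E) : Integrable g (posterior q r a) := by
  rw [posterior, integrable_tilted_iff (integrable_exp_sq r a)]
  refine hg.bdd_smul (C := 1) (integrable_exp_sq r a).aestronglyMeasurable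
    (ae_of_all _ fun v => ?_)
  · rw [Real.norm_eq_abs, abs_of_pos (Real.exp_pos _)]
    exact exp_neg_sq_le_one _

lemma integrable_sub_smul (hq : MemLp id 2 q) (r : ℝ) (a : E) :
    Integrable (fun v => ‖a - r • v‖ ^ 2) q :=
  ((memLp_const a).sub (hq.const_smul r)).integrable_norm_pow (by norm_num)

/-- **Chebyshev's correlation inequality**: the posterior favours small residuals `‖a - r v‖`, so
their mean square is at most the one under the prior. -/
lemma integral_sq_posterior_le (hq : MemLp id 2 q) (r : ℝ) (a : E) :
    ∫ v, ‖a - r • v‖ ^ 2 ∂(posterior q r a) ≤ ∫ v, ‖a - r • v‖ ^ 2 ∂q := by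
  set m := ∫ v, ‖a - r • v‖ ^ 2 ∂q with hm
  have hi := integrable_sub_smul hq r a
  have hw := integrable_exp_sq (q := q) r a
  have hwi := integrable_exp_mul hi (w := fun v => a - r • v) (by fun_prop)
  rw [integral_posterior, smul_eq_mul, inv_mul_le_iff₀ (likelihood_pos r a), ← sub_nonpos,
    likelihood, ← integral_mul_const]
  simp only [smul_eq_mul]
  rw [← integral_sub hwi (hw.mul_const m)]
  have h0 : ∫ v, Real.exp (-m / 2) * (‖a - r • v‖ ^ 2 - m) ∂q = 0 := by
    rw [integral_const_mul, integral_sub hi (integrable_const _)]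
    simp [hm]
  rw [← h0]
  refine integral_mono (hwi.sub (hw.mul_const m)) ((hi.sub (integrable_const _)).const_mul _)
    fun v => ?_
  simp only
  -- `exp(-t / 2)` is decreasing in `t`, so `exp(-t / 2) (t - m) ≤ exp(-m / 2) (t - m)`
  rcases le_total m (‖a - r • v‖ ^ 2) with h | h
  · have : Real.exp (-‖a - r • v‖ ^ 2 / 2) ≤ Real.exp (-m / 2) := Real.exp_le_exp.2 (by linarith)
    nlinarith
  · have : Real.exp (-m / 2) ≤ Real.exp (-‖a - r • v‖ ^ 2 / 2) := Real.exp_le_exp.2 (by linarith)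
    nlinarith

lemma log_likelihood_nonpos (r : ℝ) (a : E) : Real.log (likelihood q r a) ≤ 0 := by
  refine Real.log_nonpos (likelihood_pos r a).le ?_
  calc likelihood q r a ≤ ∫ _, (1 : ℝ) ∂q :=
        integral_mono (integrable_exp_sq r a) (integrable_const _) fun v => exp_neg_sq_le_one _
    _ = 1 := by simp

/-- Jensen's inequality for the exponential bounds the likelihood from below. -/
lemma neg_le_log_likelihood (hq : MemLp id 2 q) (r : ℝ) (a : E) :
    -(∫ v, ‖a - r • v‖ ^ 2 ∂q) / 2 ≤ Real.log (likelihood q r a) := by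
  rw [Real.le_log_iff_exp_le (likelihood_pos r a)]
  have h := (convexOn_exp).map_integral_le (μ := q) (f := fun v => -‖a - r • v‖ ^ 2 / 2)
    Real.continuous_exp.continuousOn isClosed_univ (by simp)
    ((integrable_sub_smul hq r a).neg.div_const 2) (integrable_exp_sq r a)
  refine le_trans (le_of_eq ?_) h
  rw [integral_div, integral_neg]

lemma integral_sq_le (hq : MemLp id 2 q) (r : ℝ) (x z : E) :
    ∫ v, ‖(r • x + z) - r • v‖ ^ 2 ∂q ≤
      4 * r ^ 2 * ‖x‖ ^ 2 + 4 * ‖z‖ ^ 2 + 2 * r ^ 2 * ∫ v, ‖v‖ ^ 2 ∂q := by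
  have hi : Integrable (fun v => ‖v‖ ^ 2) q := hq.integrable_norm_pow (by norm_num)
  calc ∫ v, ‖(r • x + z) - r • v‖ ^ 2 ∂q
      ≤ ∫ v, ((4 * r ^ 2 * ‖x‖ ^ 2 + 4 * ‖z‖ ^ 2) + 2 * r ^ 2 * ‖v‖ ^ 2) ∂q := by
        refine integral_mono (integrable_sub_smul hq r _)
          ((integrable_const _).add (hi.const_mul _)) fun v => ?_
        have h1 : ‖(r • x + z) - r • v‖ ≤ |r| * ‖x‖ + ‖z‖ + |r| * ‖v‖ := by
          refine (norm_sub_le _ _).trans (add_le_add ((norm_add_le _ _).trans ?_) ?_)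
          · rw [norm_smul, Real.norm_eq_abs]
          · rw [norm_smul, Real.norm_eq_abs]
        have h2 : ‖(r • x + z) - r • v‖ ^ 2 ≤ (|r| * ‖x‖ + ‖z‖ + |r| * ‖v‖) ^ 2 := by gcongr
        have h3 : r ^ 2 = |r| ^ 2 := (sq_abs r).symm
        simp only
        rw [h3]
        nlinarith [sq_nonneg (|r| * ‖x‖ + ‖z‖ - |r| * ‖v‖), sq_nonneg (|r| * ‖x‖ - ‖z‖)]
    _ = _ := by
        rw [integral_add (integrable_const _) (hi.const_mul _), integral_const_mul]
        simp

/-- The residuals `a - r v` and the errors `x - v` are tied by `a - r v = r (x - v) + z`, so a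
bound on the former gives one on the latter. -/
lemma integral_sq_sub_posterior_le (hq : MemLp id 2 q) {r : ℝ} (hr : r ≠ 0) (x z : E) :
    ∫ v, ‖x - v‖ ^ 2 ∂(posterior q r (r • x + z)) ≤
      2 / r ^ 2 * (∫ v, ‖(r • x + z) - r • v‖ ^ 2 ∂q + ‖z‖ ^ 2) := by
  have hi := integrable_posterior (integrable_sub_smul hq r (r • x + z)) r (r • x + z)
  have hi' := integrable_posterior (integrable_sub_smul hq 1 x) r (r • x + z)
  simp only [one_smul] at hi'
  refine le_trans (integral_mono hi' ((hi.add (integrable_const (‖z‖ ^ 2))).const_mul (2 / r ^ 2))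
    fun v => ?_) ?_
  · have h1 : r • (x - v) = ((r • x + z) - r • v) - z := by rw [smul_sub]; abel
    have h2 : |r| * ‖x - v‖ ≤ ‖(r • x + z) - r • v‖ + ‖z‖ := by
      rw [← Real.norm_eq_abs, ← norm_smul, h1]; exact norm_sub_le _ _
    have h3 : (|r| * ‖x - v‖) ^ 2 ≤ (‖(r • x + z) - r • v‖ + ‖z‖) ^ 2 := by gcongr
    rw [mul_pow, sq_abs] at h3
    simp only [Pi.add_apply]
    rw [div_mul_eq_mul_div, le_div_iff₀ (by positivity)]
    nlinarith [sq_nonneg (‖(r • x + z) - r • v‖ - ‖z‖)]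
  · simp only [Pi.add_apply]
    rw [integral_const_mul, integral_add hi (integrable_const _)]
    have := integral_sq_posterior_le hq r (r • x + z)
    simp only [integral_const, probReal_univ, one_smul]
    gcongr

lemma integral_const_sub_posterior (hq : MemLp id 2 q) (r : ℝ) (a x : E) :
    ∫ v, (x - v) ∂(posterior q r a) = x - posteriorMean q r a := by
  have hi : Integrable (fun v : E => v) (posterior q r a) :=
    integrable_posterior (hq.integrable (by norm_num)) r a
  rw [integral_sub (integrable_const _) hi]
  simp [posteriorMean]

/-- The bias-variance decomposition. -/
lemma integral_sq_sub_eq {π : Measure E} [IsProbabilityMeasure π] (hπ : MemLp id 2 π) (d : E) :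
    ∫ v, ‖v - d‖ ^ 2 ∂π = ∫ v, ‖v - ∫ u, u ∂π‖ ^ 2 ∂π + ‖∫ u, u ∂π - d‖ ^ 2 := by
  set m := ∫ u, u ∂π
  have hi : Integrable (fun v : E => v) π := hπ.integrable (by norm_num)
  have h2 : Integrable (fun v : E => ‖v - m‖ ^ 2) π :=
    (hπ.sub (memLp_const m)).integrable_norm_pow (by norm_num)
  have h3 : Integrable (fun v : E => 2 * ⟪v - m, m - d⟫) π :=
    ((hi.sub (integrable_const m)).inner_const _).const_mul 2
  have h4 : ∀ v : E, ‖v - d‖ ^ 2 = ‖v - m‖ ^ 2 + 2 * ⟪v - m, m - d⟫ + ‖m - d‖ ^ 2 := by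
    intro v
    rw [← norm_add_sq_real]
    congr 2
    abel
  rw [funext h4]
  have h23 : Integrable (fun v : E => ‖v - m‖ ^ 2 + 2 * ⟪v - m, m - d⟫) π := h2.add h3
  rw [integral_add h23 (integrable_const _), integral_add h2 h3, integral_const_mul]
  have h5 : ∫ v, ⟪v - m, m - d⟫ ∂π = 0 := by
    rw [funext fun v : E => real_inner_comm (m - d) (v - m)]
    have h6 : Integrable (fun v : E => v - m) π := hi.sub (integrable_const m)
    rw [integral_inner h6, integral_sub hi (integrable_const _)]
    simp only [integral_const, probReal_univ, one_smul]
    rw [sub_self, inner_zero_right]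
  simp [h5]

lemma memLp_posterior (hq : MemLp id 2 q) (r : ℝ) (a : E) :
    MemLp id 2 (posterior q r a) :=
  (memLp_two_iff_integrable_sq_norm (by fun_prop)).2
    (integrable_posterior ((memLp_two_iff_integrable_sq_norm (by fun_prop)).1 hq) r a)

lemma sq_norm_sub_posteriorMean_le (hq : MemLp id 2 q) {r : ℝ} (hr : r ≠ 0) (x z : E) :
    ‖x - posteriorMean q r (r • x + z)‖ ^ 2 ≤
      2 / r ^ 2 * (∫ v, ‖(r • x + z) - r • v‖ ^ 2 ∂q + ‖z‖ ^ 2) := by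
  refine le_trans ?_ (integral_sq_sub_posterior_le hq hr x z)
  have h := integral_sq_sub_eq (memLp_posterior hq r (r • x + z)) x
  simp_rw [norm_sub_rev x]
  rw [h]
  exact le_add_of_nonneg_left (integral_nonneg fun _ => by positivity)

lemma integrable_inner_sub (hq : MemLp id 2 q) (r : ℝ) (a x : E) :
    Integrable (fun v => ⟪a - r • v, x - v⟫) q :=
  (((integrable_sub_smul hq r a).add (integrable_sub_smul hq 1 x)).mono' (by fun_prop)
    (ae_of_all _ fun v => by
      simp only [Pi.add_apply, one_smul, Real.norm_eq_abs]
      have := abs_real_inner_le_norm (a - r • v) (x - v)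
      nlinarith [sq_nonneg (‖a - r • v‖ - ‖x - v‖), sq_nonneg ‖a - r • v‖, sq_nonneg ‖x - v‖]))

lemma abs_integral_inner_posterior_le (hq : MemLp id 2 q) {r : ℝ} (hr : 0 < r) (x z : E) :
    |∫ v, ⟪(r • x + z) - r • v, x - v⟫ ∂(posterior q r (r • x + z))| ≤
      2 / r * (∫ v, ‖(r • x + z) - r • v‖ ^ 2 ∂q + ‖z‖ ^ 2) := by
  have hi := integrable_posterior (integrable_sub_smul hq r (r • x + z)) r (r • x + z)
  refine abs_integral_le_integral_abs.trans (le_trans (integral_mono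
    (integrable_posterior (integrable_inner_sub hq r _ x) r _).abs
    ((hi.add (integrable_const (‖z‖ ^ 2))).const_mul (2 / r)) fun v => ?_) ?_)
  · have h1 : r • (x - v) = ((r • x + z) - r • v) - z := by rw [smul_sub]; abel
    set w := (r • x + z) - r • v
    have h2 : r * ⟪w, x - v⟫ = ‖w‖ ^ 2 - ⟪w, z⟫ := by
      rw [← real_inner_smul_right, h1, inner_sub_right, real_inner_self_eq_norm_sq]
    have h3 := abs_le.1 (abs_real_inner_le_norm w z)
    simp only [Pi.add_apply]
    rw [div_mul_eq_mul_div, le_div_iff₀ hr, ← abs_of_pos hr, ← abs_mul, abs_of_pos hr, mul_comm, h2]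
    refine abs_le.2 ⟨?_, ?_⟩ <;> nlinarith [sq_nonneg (‖w‖ - ‖z‖), sq_nonneg ‖w‖, sq_nonneg ‖z‖]
  · simp only [Pi.add_apply]
    rw [integral_const_mul, integral_add hi (integrable_const _)]
    have := integral_sq_posterior_le hq r (r • x + z)
    simp only [integral_const, probReal_univ, one_smul]
    gcongr

end Posterior

/-! ### Derivatives of the likelihood and of the posterior mean -/

section Derivatives

variable {E : Type*} [NormedAddCommGroup E] [InnerProductSpace ℝ E] [FiniteDimensional ℝ E]
  [MeasurableSpace E] [BorelSpace E] {q : Measure E} [IsProbabilityMeasure q]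

lemma mul_exp_neg_sq_le_one (t : ℝ) : t * Real.exp (-t ^ 2 / 2) ≤ 1 := by
  have h := Real.add_one_le_exp (t ^ 2 / 2)
  have h2 : t ≤ Real.exp (t ^ 2 / 2) := by nlinarith [sq_nonneg (t - 1)]
  rw [show -t ^ 2 / 2 = -(t ^ 2 / 2) by ring, Real.exp_neg]
  exact (mul_inv_le_iff₀ (Real.exp_pos _)).2 (by linarith)

/-- Differentiation of a Gaussian integral along an affine family `A + t B` of residuals. Since
`‖w‖ exp(-‖w‖² / 2) ≤ 1`, the integrability of `g ‖B‖` is all the domination that is needed. -/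
lemma hasDerivAt_integral_exp_neg_sq {A B : E → E} {g : E → ℝ} (hA : Measurable A)
    (hB : Measurable B) (hg : Integrable g q) (hgB : Integrable (fun v => g v * ‖B v‖) q)
    (t₀ : ℝ) :
    HasDerivAt (fun t : ℝ => ∫ v, Real.exp (-‖A v + t • B v‖ ^ 2 / 2) * g v ∂q)
      (∫ v, Real.exp (-‖A v + t₀ • B v‖ ^ 2 / 2) * (-⟪A v + t₀ • B v, B v⟫ * g v) ∂q) t₀ := by
  refine (hasDerivAt_integral_of_dominated_loc_of_deriv_le (s := univ)
    (F := fun t v => Real.exp (-‖A v + t • B v‖ ^ 2 / 2) * g v) (x₀ := t₀)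
    (F' := fun t v => Real.exp (-‖A v + t • B v‖ ^ 2 / 2) * (-⟪A v + t • B v, B v⟫ * g v))
    (bound := fun v => |g v * ‖B v‖|) univ_mem (Eventually.of_forall fun t => ?_)
    (integrable_exp_mul (w := fun v => A v + t₀ • B v) hg (by fun_prop)) ?_
    (ae_of_all _ fun v t _ => ?_) hgB.abs
    (ae_of_all _ fun v t _ => ?_)).2
  · exact (integrable_exp_mul (w := fun v => A v + t • B v) hg (by fun_prop)).aestronglyMeasurable
  · have := hg.aestronglyMeasurable
    have h1 : Measurable fun v => -‖A v + t₀ • B v‖ ^ 2 / 2 := by fun_prop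
    have h2 : Measurable fun v => -⟪A v + t₀ • B v, B v⟫ := by fun_prop
    exact (Real.measurable_exp.comp h1).aestronglyMeasurable.mul (h2.aestronglyMeasurable.mul this)
  · set w := A v + t • B v
    have h1 := abs_real_inner_le_norm w (B v)
    have h2 := mul_exp_neg_sq_le_one ‖w‖
    rw [Real.norm_eq_abs, abs_mul, abs_mul, abs_neg, abs_mul, abs_of_pos (Real.exp_pos _), abs_norm]
    calc Real.exp (-‖w‖ ^ 2 / 2) * (|⟪w, B v⟫| * |g v|)
        ≤ Real.exp (-‖w‖ ^ 2 / 2) * (‖w‖ * ‖B v‖ * |g v|) := by gcongr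
      _ = (‖w‖ * Real.exp (-‖w‖ ^ 2 / 2)) * (|g v| * ‖B v‖) := by ring
      _ ≤ 1 * (|g v| * ‖B v‖) := by gcongr
      _ = _ := one_mul _
  · have h1 : HasDerivAt (fun t : ℝ => A v + t • B v) (B v) t := by
      simpa using ((hasDerivAt_id t).smul_const (B v)).const_add (A v)
    refine (((h1.norm_sq.neg.div_const 2).exp).mul_const (g v)).congr_deriv ?_
    simp only [Pi.neg_apply]
    ring

/-- The derivative of the log-likelihood in the inverse noise level `r`, at fixed `x` and `z`. -/
lemma hasDerivAt_log_likelihood (hq : MemLp id 2 q) (x z : E) (r : ℝ) :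
    HasDerivAt (fun r : ℝ => Real.log (likelihood q r (r • x + z)))
      (-∫ v, ⟪(r • x + z) - r • v, x - v⟫ ∂(posterior q r (r • x + z))) r := by
  have hi : Integrable (fun v : E => v) q := hq.integrable (by norm_num)
  have h := hasDerivAt_integral_exp_neg_sq (q := q) (A := fun _ => z) (B := fun v => x - v)
    (g := fun _ => 1) (by fun_prop) (by fun_prop) (integrable_const _)
    (by simpa using ((integrable_const x).sub hi).norm) r
  have e : ∀ (t : ℝ) (v : E), z + t • (x - v) = (t • x + z) - t • v := by
    intro t v; rw [smul_sub]; abel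
  simp only [e, mul_one] at h
  have h2 := h.log (likelihood_pos (q := q) r (r • x + z)).ne'
  refine h2.congr_deriv ?_
  rw [integral_posterior, smul_eq_mul, div_eq_inv_mul, ← mul_neg, ← integral_neg]
  simp [likelihood]

/-- The derivative of a coordinate of the posterior mean in the observation is, up to the factor
`r`, the posterior variance of this coordinate. -/
lemma hasLineDerivAt_posteriorMean (hq : MemLp id 2 q) (r : ℝ) (a e : E) :
    HasLineDerivAt ℝ (fun a => ⟪posteriorMean q r a, e⟫)
      (r * (∫ v, ⟪v, e⟫ ^ 2 ∂(posterior q r a) - ⟪posteriorMean q r a, e⟫ ^ 2)) a e := by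
  have hi : Integrable (fun v : E => v) q := hq.integrable (by norm_num)
  have hie : Integrable (fun v : E => ⟪v, e⟫) q := hi.inner_const e
  have hi2 : Integrable (fun v : E => ⟪v, e⟫ ^ 2) q :=
    (MemLp.inner_const hq e).integrable_sq
  have hN := hasDerivAt_integral_exp_neg_sq (q := q) (A := fun v => a - r • v) (B := fun _ => e)
    (g := fun v => ⟪v, e⟫) (by fun_prop) (by fun_prop) hie (hie.mul_const _) 0
  have hL := hasDerivAt_integral_exp_neg_sq (q := q) (A := fun v => a - r • v) (B := fun _ => e)
    (g := fun v => 1) (by fun_prop) (by fun_prop) (integrable_const _)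
    (integrable_const _) 0
  have e1 : ∀ (t : ℝ) (v : E), a - r • v + t • e = (a + t • e) - r • v := fun t v => by abel
  have hm : ∀ b : E, ⟪posteriorMean q r b, e⟫ =
      (∫ v, Real.exp (-‖b - r • v‖ ^ 2 / 2) * ⟪v, e⟫ ∂q) /
        ∫ v, Real.exp (-‖b - r • v‖ ^ 2 / 2) * 1 ∂q := by
    intro b
    rw [real_inner_comm, posteriorMean, ← integral_inner (integrable_posterior hi r b),
      integral_posterior, div_eq_inv_mul]
    simp [likelihood, real_inner_comm]
  have hpos : ∀ b : E, ∫ v, Real.exp (-‖b - r • v‖ ^ 2 / 2) * 1 ∂q ≠ 0 := by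
    intro b
    simpa [likelihood] using (likelihood_pos (q := q) r b).ne'
  simp only [e1] at hN hL
  have h := hN.div hL (hpos _)
  unfold HasLineDerivAt
  simp_rw [hm]
  refine h.congr_deriv ?_
  simp only [zero_smul, add_zero]
  set w : E → ℝ := fun v => Real.exp (-‖a - r • v‖ ^ 2 / 2)
  set L := ∫ v, w v * 1 ∂q with hLdef
  have hL0 : L ≠ 0 := hpos a
  have hw1 : Integrable (fun v => w v * ⟪v, e⟫) q := integrable_exp_mul hie (by fun_prop)
  have hw2 : Integrable (fun v => w v * ⟪v, e⟫ ^ 2) q := integrable_exp_mul hi2 (by fun_prop)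
  have hw0 : Integrable (fun v => w v * 1) q :=
    integrable_exp_mul (integrable_const _) (by fun_prop)
  have hN' : ∫ v, w v * (-⟪a - r • v, e⟫ * ⟪v, e⟫) ∂q =
      r * ∫ v, w v * ⟪v, e⟫ ^ 2 ∂q - ⟪a, e⟫ * ∫ v, w v * ⟪v, e⟫ ∂q := by
    rw [← integral_const_mul, ← integral_const_mul,
      ← integral_sub (hw2.const_mul _) (hw1.const_mul _)]
    congr 1
    ext v
    rw [inner_sub_left, real_inner_smul_left]
    ring
  have hL' : ∫ v, w v * (-⟪a - r • v, e⟫ * 1) ∂q =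
      r * ∫ v, w v * ⟪v, e⟫ ∂q - ⟪a, e⟫ * L := by
    rw [hLdef, ← integral_const_mul, ← integral_const_mul,
      ← integral_sub (hw1.const_mul _) (hw0.const_mul _)]
    congr 1
    ext v
    rw [inner_sub_left, real_inner_smul_left]
    ring
  have hP : ∫ v, ⟪v, e⟫ ^ 2 ∂(posterior q r a) = (∫ v, w v * ⟪v, e⟫ ^ 2 ∂q) / L := by
    rw [integral_posterior, div_eq_inv_mul, hLdef]
    simp [likelihood, w]
  have hfold : ∫ v, Real.exp (-‖a - r • v‖ ^ 2 / 2) * ⟪v, e⟫ ∂q = ∫ v, w v * ⟪v, e⟫ ∂q := rfl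
  rw [hN', hL', hP, hfold]
  generalize ∫ v, w v * ⟪v, e⟫ ∂q = N
  field_simp
  ring

end Derivatives

/-! ### The I-MMSE relation -/

section ExpectedLogLikelihood

variable {E : Type*} [NormedAddCommGroup E] [InnerProductSpace ℝ E] [FiniteDimensional ℝ E]
  [MeasurableSpace E] [BorelSpace E] {p q : Measure E} [IsProbabilityMeasure p]
  [IsProbabilityMeasure q]

lemma stronglyMeasurable_integral_exp {α F : Type*} [MeasurableSpace α] [NormedAddCommGroup F]
    [NormedSpace ℝ F] {a : α → E} (ha : Measurable a) {h : α × E → F} (hh : StronglyMeasurable h)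
    (r : ℝ) :
    StronglyMeasurable fun w => ∫ v, Real.exp (-‖a w - r • v‖ ^ 2 / 2) • h (w, v) ∂q := by
  refine StronglyMeasurable.integral_prod_right
    (f := fun w v => Real.exp (-‖a w - r • v‖ ^ 2 / 2) • h (w, v)) ?_
  refine StronglyMeasurable.smul (f := fun y : α × E => Real.exp (-‖a y.1 - r • y.2‖ ^ 2 / 2))
    (Measurable.stronglyMeasurable ?_) hh
  fun_prop

lemma measurable_likelihood (r : ℝ) : Measurable (likelihood q r) := by
  have h := (stronglyMeasurable_integral_exp (q := q) measurable_id
    (h := fun _ : E × E => (1 : ℝ)) stronglyMeasurable_const r).measurable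
  simp only [smul_eq_mul, mul_one] at h
  exact h

lemma stronglyMeasurable_integral_posterior {α F : Type*} [MeasurableSpace α]
    [NormedAddCommGroup F] [NormedSpace ℝ F] {a : α → E} (ha : Measurable a) {h : α × E → F}
    (hh : StronglyMeasurable h) (r : ℝ) :
    StronglyMeasurable fun w => ∫ v, h (w, v) ∂(posterior q r (a w)) := by
  simp_rw [integral_posterior]
  exact (((measurable_likelihood r).comp ha).inv.stronglyMeasurable).smul
    (stronglyMeasurable_integral_exp ha hh r)

lemma measurable_posteriorMean (r : ℝ) : Measurable (posteriorMean q r) :=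
  (stronglyMeasurable_integral_posterior (q := q) measurable_id
    (h := fun y : E × E => y.2) (by fun_prop) r).measurable

lemma memLp_two_id_stdGaussian : MemLp id 2 (stdGaussian E) :=
  IsGaussian.memLp_id _ _ (by norm_num)

lemma integrable_sq_stdGaussian : Integrable (fun z : E => ‖z‖ ^ 2) (stdGaussian E) :=
  memLp_two_id_stdGaussian.integrable_norm_pow (by norm_num)

lemma integrable_sq_norm_prod (hp : MemLp id 2 p) (c₁ c₂ c₃ : ℝ) :
    Integrable (fun w : E × E => c₁ * ‖w.1‖ ^ 2 + c₂ * ‖w.2‖ ^ 2 + c₃) (p.prod (stdGaussian E)) :=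
  ((((hp.integrable_norm_pow (by norm_num)).comp_fst _).const_mul c₁).add
    ((integrable_sq_stdGaussian.comp_snd _).const_mul c₂)).add (integrable_const c₃)

lemma two_div_sq_mul_le (hq : MemLp id 2 q) {r : ℝ} (hr : r ≠ 0) (x z : E) :
    2 / r ^ 2 * (∫ v, ‖(r • x + z) - r • v‖ ^ 2 ∂q + ‖z‖ ^ 2) ≤
      8 * ‖x‖ ^ 2 + (10 / r ^ 2) * ‖z‖ ^ 2 + 4 * ∫ v, ‖v‖ ^ 2 ∂q := by
  calc _ ≤ 2 / r ^ 2 * ((4 * r ^ 2 * ‖x‖ ^ 2 + 4 * ‖z‖ ^ 2 + 2 * r ^ 2 * ∫ v, ‖v‖ ^ 2 ∂q)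
        + ‖z‖ ^ 2) := by
        have := integral_sq_le hq r x z
        gcongr
    _ = _ := by field_simp; ring

lemma sq_norm_sub_posteriorMean_le_of_moments (hq : MemLp id 2 q) {r : ℝ} (hr : r ≠ 0) (x z : E) :
    ‖x - posteriorMean q r (r • x + z)‖ ^ 2 ≤
      8 * ‖x‖ ^ 2 + (10 / r ^ 2) * ‖z‖ ^ 2 + 4 * ∫ v, ‖v‖ ^ 2 ∂q :=
  (sq_norm_sub_posteriorMean_le hq hr x z).trans (two_div_sq_mul_le hq hr x z)

lemma integrable_sq_norm_sub_posteriorMean (hp : MemLp id 2 p) (hq : MemLp id 2 q) {r : ℝ}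
    (hr : r ≠ 0) :
    Integrable (fun w : E × E => ‖w.1 - posteriorMean q r (r • w.1 + w.2)‖ ^ 2)
      (p.prod (stdGaussian E)) := by
  have := measurable_posteriorMean (q := q) r
  refine (integrable_sq_norm_prod hp 8 (10 / r ^ 2) (4 * ∫ v, ‖v‖ ^ 2 ∂q)).mono'
    (Measurable.aestronglyMeasurable (by fun_prop)) (ae_of_all _ fun w => ?_)
  rw [Real.norm_eq_abs, abs_of_nonneg (by positivity)]
  exact sq_norm_sub_posteriorMean_le_of_moments hq hr w.1 w.2

lemma integrable_log_likelihood (hp : MemLp id 2 p) (hq : MemLp id 2 q) (r : ℝ) :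
    Integrable (fun w : E × E => Real.log (likelihood q r (r • w.1 + w.2)))
      (p.prod (stdGaussian E)) := by
  have := measurable_likelihood (q := q) r
  refine (integrable_sq_norm_prod hp (2 * r ^ 2) 2 (r ^ 2 * ∫ v, ‖v‖ ^ 2 ∂q)).mono'
    (Measurable.aestronglyMeasurable (by fun_prop)) (ae_of_all _ fun w => ?_)
  rw [Real.norm_eq_abs, abs_of_nonpos (log_likelihood_nonpos _ _)]
  have h1 := neg_le_log_likelihood hq r (r • w.1 + w.2)
  have h2 := integral_sq_le hq r w.1 w.2
  linarith

section Stein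

lemma memLp_sub_posteriorMean (hq : MemLp id 2 q) {r : ℝ} (hr : r ≠ 0) (x : E) :
    MemLp (fun z : E => x - posteriorMean q r (r • x + z)) 2 (stdGaussian E) := by
  have := measurable_posteriorMean (q := q) r
  refine (memLp_two_iff_integrable_sq_norm (Measurable.aestronglyMeasurable (by fun_prop))).2 ?_
  refine ((integrable_sq_stdGaussian.const_mul (10 / r ^ 2)).add
    (integrable_const (8 * ‖x‖ ^ 2 + 4 * ∫ v, ‖v‖ ^ 2 ∂q))).mono'
    (Measurable.aestronglyMeasurable (by fun_prop)) (ae_of_all _ fun z => ?_)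
  rw [Real.norm_eq_abs, abs_of_nonneg (by positivity)]
  have := sq_norm_sub_posteriorMean_le_of_moments hq hr x z
  simp only [Pi.add_apply]
  linarith

lemma integrable_sq_posterior (hq : MemLp id 2 q) (r : ℝ) (a : E) :
    Integrable (fun v : E => ‖v‖ ^ 2) (posterior q r a) :=
  (memLp_posterior hq r a).integrable_norm_pow (by norm_num)

lemma integrable_integral_sq_posterior (hq : MemLp id 2 q) {r : ℝ} (hr : r ≠ 0) (x : E) :
    Integrable (fun z : E => ∫ v, ‖v‖ ^ 2 ∂(posterior q r (r • x + z))) (stdGaussian E) := by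
  refine ((integrable_sq_stdGaussian.const_mul (20 / r ^ 2)).add
    (integrable_const (18 * ‖x‖ ^ 2 + 8 * ∫ v, ‖v‖ ^ 2 ∂q))).mono'
    (stronglyMeasurable_integral_posterior (a := fun z => r • x + z) (by fun_prop)
      (h := fun y : E × E => ‖y.2‖ ^ 2) (by fun_prop) r).aestronglyMeasurable
    (ae_of_all _ fun z => ?_)
  rw [Real.norm_eq_abs, abs_of_nonneg (integral_nonneg fun _ => by positivity)]
  set π := posterior q r (r • x + z)
  have hi' : Integrable (fun v => ‖x - v‖ ^ 2) π := by
    have := integrable_posterior (integrable_sub_smul hq 1 x) r (r • x + z)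
    simpa only [one_smul] using this
  have h1 : ∫ v, ‖v‖ ^ 2 ∂π ≤ ∫ v, (2 * ‖x‖ ^ 2 + 2 * ‖x - v‖ ^ 2) ∂π := by
    refine integral_mono (integrable_sq_posterior hq r _)
      ((integrable_const _).add (hi'.const_mul 2)) fun v => ?_
    have h2 : ‖v‖ ≤ ‖x‖ + ‖x - v‖ := by
      calc ‖v‖ = ‖x - (x - v)‖ := by congr 1; abel
        _ ≤ _ := norm_sub_le _ _
    have h3 : ‖v‖ ^ 2 ≤ (‖x‖ + ‖x - v‖) ^ 2 := by gcongr
    simp only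
    nlinarith [sq_nonneg (‖x‖ - ‖x - v‖)]
  rw [integral_add (integrable_const _) (hi'.const_mul 2),
    integral_const_mul 2 fun v => ‖x - v‖ ^ 2] at h1
  have h4 := integral_sq_sub_posterior_le hq hr x z
  have h5 := two_div_sq_mul_le hq hr x z
  simp only [integral_const, probReal_univ, one_smul] at h1
  simp only [Pi.add_apply]
  have h6 : (20 / r ^ 2) * ‖z‖ ^ 2 = 2 * ((10 / r ^ 2) * ‖z‖ ^ 2) := by ring
  rw [h6]
  linarith

/-- Stein's lemma for the posterior mean: its divergence is `r` times the total posterior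
variance. -/
lemma integral_inner_sub_posteriorMean (hq : MemLp id 2 q) {r : ℝ} (hr : r ≠ 0) (x : E) :
    ∫ z, ⟪z, x - posteriorMean q r (r • x + z)⟫ ∂(stdGaussian E) =
      -∫ z, r * (∫ v, ‖v‖ ^ 2 ∂(posterior q r (r • x + z))
        - ‖posteriorMean q r (r • x + z)‖ ^ 2) ∂(stdGaussian E) := by
  have hm := measurable_posteriorMean (q := q) r
  let b := stdOrthonormalBasis ℝ E
  have hD := memLp_sub_posteriorMean hq hr x
  have hZ : MemLp (fun z : E => z) 2 (stdGaussian E) := memLp_two_id_stdGaussian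
  have hM : MemLp (fun z : E => posteriorMean q r (r • x + z)) 2 (stdGaussian E) := by
    have := (memLp_const x).sub hD
    refine this.ae_eq (ae_of_all _ fun z => ?_)
    simp
  have hsq := integrable_integral_sq_posterior hq hr x
  have hM2 : ∀ i, Integrable (fun z : E => ⟪posteriorMean q r (r • x + z), b i⟫ ^ 2)
      (stdGaussian E) := fun i => (hM.inner_const (b i)).integrable_sq
  have hV : ∀ i, Integrable (fun z : E => ∫ v, ⟪v, b i⟫ ^ 2 ∂(posterior q r (r • x + z)))
      (stdGaussian E) := by
    intro i
    refine hsq.mono' (stronglyMeasurable_integral_posterior (a := fun z => r • x + z)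
      (by fun_prop) (h := fun y : E × E => ⟪y.2, b i⟫ ^ 2) (by fun_prop) r).aestronglyMeasurable
      (ae_of_all _ fun z => ?_)
    rw [Real.norm_eq_abs, abs_of_nonneg (integral_nonneg fun _ => by positivity)]
    refine integral_mono ((memLp_posterior hq r _).inner_const (b i)).integrable_sq
      (integrable_sq_posterior hq r _) fun v => ?_
    have h1 := abs_real_inner_le_norm v (b i)
    rw [b.norm_eq_one, mul_one] at h1
    exact sq_le_sq' (by linarith [neg_abs_le ⟪v, b i⟫]) (le_trans (le_abs_self _) h1)
  have hneg : ∀ i, Integrable (fun z : E => -(r * (∫ v, ⟪v, b i⟫ ^ 2 ∂(posterior q r (r • x + z))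
      - ⟪posteriorMean q r (r • x + z), b i⟫ ^ 2))) (stdGaussian E) := fun i =>
    (((hV i).sub (hM2 i)).const_mul r).neg
  have hstein : ∀ i, ∫ z, ⟪x - posteriorMean q r (r • x + z), b i⟫ * ⟪z, b i⟫ ∂(stdGaussian E) =
      ∫ z, -(r * (∫ v, ⟪v, b i⟫ ^ 2 ∂(posterior q r (r • x + z))
        - ⟪posteriorMean q r (r • x + z), b i⟫ ^ 2)) ∂(stdGaussian E) := by
    intro i
    refine integral_inner_mul_stdGaussian (b i) ((hD.inner_const (b i)).integrable (by norm_num))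
      (hneg i)
      ((hD.inner_const (b i)).integrable_mul (hZ.inner_const (b i))) fun z => ?_
    have h := hasLineDerivAt_posteriorMean hq r (r • x + z) (b i)
    unfold HasLineDerivAt at h ⊢
    refine (h.const_sub ⟪x, b i⟫).congr_of_eventuallyEq (Eventually.of_forall fun t => ?_)
    simp only [inner_sub_left, add_assoc]
  have hsum : ∀ z : E, ⟪z, x - posteriorMean q r (r • x + z)⟫ =
      ∑ i, ⟪x - posteriorMean q r (r • x + z), b i⟫ * ⟪z, b i⟫ := by
    intro z
    rw [real_inner_comm, ← b.sum_inner_mul_inner]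
    simp_rw [real_inner_comm z]
  simp_rw [hsum]
  rw [integral_finsetSum _ fun i _ => (hD.inner_const (b i)).integrable_mul
    (hZ.inner_const (b i))]
  simp_rw [hstein]
  rw [← integral_finsetSum _ fun i _ => hneg i, ← integral_neg]
  congr 1
  ext z
  rw [Finset.sum_neg_distrib, ← Finset.mul_sum, Finset.sum_sub_distrib]
  have h1 : ∀ v : E, ∑ i, ⟪v, b i⟫ ^ 2 = ‖v‖ ^ 2 := by
    intro v
    rw [← real_inner_self_eq_norm_sq, ← b.sum_inner_mul_inner]
    refine Finset.sum_congr rfl fun i _ => ?_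
    rw [real_inner_comm v, sq]
  have h2 : ∀ i, Integrable (fun v : E => ⟪v, b i⟫ ^ 2) (posterior q r (r • x + z)) := fun i =>
    ((memLp_posterior hq r _).inner_const (b i)).integrable_sq
  rw [h1, ← integral_finsetSum _ fun i _ => h2 i]
  simp_rw [h1]

/-- Averaged over the noise, the derivative of the log-likelihood is the squared error of the
posterior mean. -/
lemma integral_integral_inner_posterior (hq : MemLp id 2 q) {r : ℝ} (hr : r ≠ 0) (x : E) :
    ∫ z, ∫ v, ⟪(r • x + z) - r • v, x - v⟫ ∂(posterior q r (r • x + z)) ∂(stdGaussian E) =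
      r * ∫ z, ‖x - posteriorMean q r (r • x + z)‖ ^ 2 ∂(stdGaussian E) := by
  have hm := measurable_posteriorMean (q := q) r
  have hD := memLp_sub_posteriorMean hq hr x
  have hZ : MemLp (fun z : E => z) 2 (stdGaussian E) := memLp_two_id_stdGaussian
  have hM : MemLp (fun z : E => posteriorMean q r (r • x + z)) 2 (stdGaussian E) := by
    have := (memLp_const x).sub hD
    refine this.ae_eq (ae_of_all _ fun z => ?_)
    simp
  have hsq := integrable_integral_sq_posterior hq hr x
  -- the bias, the variance and the noise part of `𝔼 ⟪r (x - v) + z, x - v⟫`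
  have hpt : ∀ z : E, ∫ v, ⟪(r • x + z) - r • v, x - v⟫ ∂(posterior q r (r • x + z)) =
      r * ‖x - posteriorMean q r (r • x + z)‖ ^ 2
        + r * (∫ v, ‖v‖ ^ 2 ∂(posterior q r (r • x + z)) - ‖posteriorMean q r (r • x + z)‖ ^ 2)
        + ⟪z, x - posteriorMean q r (r • x + z)⟫ := by
    intro z
    have hπ := memLp_posterior hq r (r • x + z)
    set π := posterior q r (r • x + z)
    have hi' : Integrable (fun v => ‖v - x‖ ^ 2) π :=
      (hπ.sub (memLp_const x)).integrable_norm_pow (by norm_num)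
    have hi1 : Integrable (fun v : E => x - v) π :=
      (integrable_const x).sub (hπ.integrable (by norm_num))
    have h1 : ∀ v : E, ⟪(r • x + z) - r • v, x - v⟫ = r * ‖v - x‖ ^ 2 + ⟪z, x - v⟫ := by
      intro v
      rw [show (r • x + z) - r • v = r • (x - v) + z by rw [smul_sub]; abel, inner_add_left,
        real_inner_smul_left, real_inner_self_eq_norm_sq, norm_sub_rev]
    simp_rw [h1]
    rw [integral_add (hi'.const_mul r) (hi1.const_inner z), integral_const_mul,
      integral_inner hi1, integral_const_sub_posterior hq]
    have h2 := integral_sq_sub_eq hπ x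
    have h3 := integral_sq_sub_eq hπ 0
    simp only [sub_zero] at h3
    have h4 : posteriorMean q r (r • x + z) = ∫ u, u ∂π := rfl
    rw [h2, h3, h4, norm_sub_rev x]
    ring
  simp_rw [hpt]
  have hA : Integrable (fun z : E => r * ‖x - posteriorMean q r (r • x + z)‖ ^ 2)
      (stdGaussian E) := (hD.integrable_norm_pow (by norm_num)).const_mul r
  have hB : Integrable (fun z : E => r * (∫ v, ‖v‖ ^ 2 ∂(posterior q r (r • x + z))
      - ‖posteriorMean q r (r • x + z)‖ ^ 2)) (stdGaussian E) :=
    (hsq.sub (hM.integrable_norm_pow (by norm_num))).const_mul r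
  have hC : Integrable (fun z : E => ⟪z, x - posteriorMean q r (r • x + z)⟫) (stdGaussian E) := by
    refine ((hZ.integrable_norm_pow (by norm_num)).add
      (hD.integrable_norm_pow (by norm_num))).mono'
      (Measurable.aestronglyMeasurable (by fun_prop)) (ae_of_all _ fun z => ?_)
    simp only [Pi.add_apply, Real.norm_eq_abs]
    set y := x - posteriorMean q r (r • x + z)
    have := abs_real_inner_le_norm z y
    nlinarith [sq_nonneg (‖z‖ - ‖y‖), sq_nonneg ‖z‖, sq_nonneg ‖y‖]
  have hAB : Integrable (fun z : E => r * ‖x - posteriorMean q r (r • x + z)‖ ^ 2 +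
      r * (∫ v, ‖v‖ ^ 2 ∂(posterior q r (r • x + z))
      - ‖posteriorMean q r (r • x + z)‖ ^ 2)) (stdGaussian E) := hA.add hB
  rw [integral_add hAB hC, integral_add hA hB, integral_inner_sub_posteriorMean hq hr,
    integral_const_mul]
  ring

end Stein

/-- The expected log-likelihood under the model `q` of an observation `r x + z`, where `x ∼ p` and
`z` is standard Gaussian. -/
noncomputable def expectedLogLikelihood (p q : Measure E) (r : ℝ) : ℝ :=
  ∫ w, Real.log (likelihood q r (r • w.1 + w.2)) ∂(p.prod (stdGaussian E))

/-- The mismatched **I-MMSE relation**. -/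
lemma hasDerivAt_expectedLogLikelihood (hp : MemLp id 2 p) (hq : MemLp id 2 q) {r : ℝ}
    (hr : 0 < r) :
    HasDerivAt (expectedLogLikelihood p q)
      (-(r * ∫ w, ‖w.1 - posteriorMean q r (r • w.1 + w.2)‖ ^ 2 ∂(p.prod (stdGaussian E)))) r := by
  set M := ∫ v, ‖v‖ ^ 2 ∂q
  have hM0 : 0 ≤ M := integral_nonneg fun _ => by positivity
  have hmeas : ∀ ρ : ℝ, StronglyMeasurable fun w : E × E =>
      -∫ v, ⟪(ρ • w.1 + w.2) - ρ • v, w.1 - v⟫ ∂(posterior q ρ (ρ • w.1 + w.2)) := fun ρ =>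
    (stronglyMeasurable_integral_posterior (a := fun w : E × E => ρ • w.1 + w.2) (by fun_prop)
      (h := fun y : (E × E) × E => ⟪(ρ • y.1.1 + y.1.2) - ρ • y.2, y.1.1 - y.2⟫)
      (by fun_prop) ρ).neg
  have hbound : ∀ (w : E × E), ∀ ρ ∈ Ioo (r / 2) (2 * r),
      ‖-∫ v, ⟪(ρ • w.1 + w.2) - ρ • v, w.1 - v⟫ ∂(posterior q ρ (ρ • w.1 + w.2))‖ ≤
        64 * r * ‖w.1‖ ^ 2 + 20 / r * ‖w.2‖ ^ 2 + 32 * r * M := by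
    intro w ρ hρ
    have hρ0 : 0 < ρ := by linarith [hρ.1]
    rw [norm_neg, Real.norm_eq_abs]
    refine (abs_integral_inner_posterior_le hq hρ0 w.1 w.2).trans ?_
    have h1 := integral_sq_le hq ρ w.1 w.2
    have h2 : ρ ^ 2 ≤ 4 * r ^ 2 := by nlinarith [hρ.2]
    calc _ ≤ 2 / (r / 2) * ((4 * (4 * r ^ 2) * ‖w.1‖ ^ 2 + 4 * ‖w.2‖ ^ 2 + 2 * (4 * r ^ 2) * M)
          + ‖w.2‖ ^ 2) := by
          have h3 : 2 / ρ ≤ 2 / (r / 2) := by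
            apply div_le_div_of_nonneg_left <;> linarith [hρ.1]
          refine mul_le_mul h3 ?_ ?_ (by positivity)
          · refine add_le_add_left (h1.trans ?_) _
            gcongr
          · exact add_nonneg (integral_nonneg fun _ => by positivity) (by positivity)
      _ = _ := by field_simp; ring
  obtain ⟨hint, hd⟩ := hasDerivAt_integral_of_dominated_loc_of_deriv_le (𝕜 := ℝ) (x₀ := r)
    (s := Ioo (r / 2) (2 * r)) (μ := p.prod (stdGaussian E))
    (F := fun ρ w => Real.log (likelihood q ρ (ρ • w.1 + w.2)))
    (F' := fun ρ w =>
      -∫ v, ⟪(ρ • w.1 + w.2) - ρ • v, w.1 - v⟫ ∂(posterior q ρ (ρ • w.1 + w.2)))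
    (bound := fun w => 64 * r * ‖w.1‖ ^ 2 + 20 / r * ‖w.2‖ ^ 2 + 32 * r * M)
    (Ioo_mem_nhds (by linarith) (by linarith))
    (Eventually.of_forall fun ρ => (integrable_log_likelihood hp hq ρ).aestronglyMeasurable)
    (integrable_log_likelihood hp hq r) (hmeas r).aestronglyMeasurable
    (ae_of_all _ hbound) (integrable_sq_norm_prod hp _ _ _)
    (ae_of_all _ fun w ρ _ => hasDerivAt_log_likelihood hq w.1 w.2 ρ)
  refine hd.congr_deriv ?_
  rw [integral_prod _ hint, integral_prod _ (integrable_sq_norm_sub_posteriorMean hp hq hr.ne'),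
    ← integral_const_mul, ← integral_neg]
  congr 1
  ext x
  rw [integral_neg, integral_integral_inner_posterior hq hr.ne']

end ExpectedLogLikelihood

/-! ### The limit of large noise -/

section LargeNoise

variable {E : Type*} [NormedAddCommGroup E] [InnerProductSpace ℝ E] [FiniteDimensional ℝ E]
  [MeasurableSpace E] [BorelSpace E] {p q : Measure E} [IsProbabilityMeasure p]
  [IsProbabilityMeasure q]

/-- At `r = 0` the observation is pure noise, and the model `q` is irrelevant. -/
lemma expectedLogLikelihood_zero :
    expectedLogLikelihood p q 0 = ∫ w, -‖w.2‖ ^ 2 / 2 ∂(p.prod (stdGaussian E)) := by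
  simp [expectedLogLikelihood, likelihood]

lemma continuousAt_expectedLogLikelihood_zero (hp : MemLp id 2 p) (hq : MemLp id 2 q) :
    ContinuousAt (expectedLogLikelihood p q) 0 := by
  set M := ∫ v, ‖v‖ ^ 2 ∂q
  have hM0 : 0 ≤ M := integral_nonneg fun _ => by positivity
  refine continuousAt_of_dominated (bound := fun w : E × E => 2 * ‖w.1‖ ^ 2 + 2 * ‖w.2‖ ^ 2 + M)
    (Eventually.of_forall fun ρ => (integrable_log_likelihood hp hq ρ).aestronglyMeasurable) ?_
    (integrable_sq_norm_prod hp _ _ _)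
    (ae_of_all _ fun w => (hasDerivAt_log_likelihood hq w.1 w.2 0).continuousAt)
  filter_upwards [Ioo_mem_nhds (show (-1 : ℝ) < 0 by norm_num) (show (0 : ℝ) < 1 by norm_num)]
    with ρ hρ
  refine ae_of_all _ fun w => ?_
  have h0 : ρ ^ 2 ≤ 1 := by nlinarith [hρ.1, hρ.2]
  rw [Real.norm_eq_abs, abs_of_nonpos (log_likelihood_nonpos _ _)]
  have h1 := neg_le_log_likelihood hq ρ (ρ • w.1 + w.2)
  have h2 := integral_sq_le hq ρ w.1 w.2
  nlinarith [mul_le_mul_of_nonneg_right h0 (sq_nonneg ‖w.1‖), mul_le_mul_of_nonneg_right h0 hM0]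

lemma tendsto_expectedLogLikelihood_sub (hp : MemLp id 2 p) (hq : MemLp id 2 q) :
    Tendsto (fun s : ℝ => expectedLogLikelihood p p s⁻¹ - expectedLogLikelihood p q s⁻¹) atTop
      (𝓝 0) := by
  have h := ((continuousAt_expectedLogLikelihood_zero hp hp).sub
    (continuousAt_expectedLogLikelihood_zero hp hq)).tendsto.comp tendsto_inv_atTop_zero
  simpa [expectedLogLikelihood_zero, Function.comp_def] using h

end LargeNoise

/-! ### The noisy laws, the denoiser and their divergence -/

section Channel

variable {n : ℕ} {p q : Measure (EuclideanSpace ℝ (Fin n))} [IsProbabilityMeasure p]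
  [IsProbabilityMeasure q] {s : ℝ}

/-- The normalising constant of the density of `N(0, s² I)`. -/
noncomputable def gaussianConst (n : ℕ) (s : ℝ) : ℝ :=
  |(s ^ n)⁻¹| * (2 * Real.pi) ^ (-(n / 2 : ℝ))

lemma gaussianConst_pos (hs : 0 < s) : 0 < gaussianConst n s := by
  unfold gaussianConst; positivity

lemma lintegral_stdGaussian_comp (hs : 0 < s) (x : EuclideanSpace ℝ (Fin n))
    {f : EuclideanSpace ℝ (Fin n) → ℝ≥0∞} (hf : Measurable f) :
    ∫⁻ z, f (x + s • z) ∂(stdGaussian (EuclideanSpace ℝ (Fin n))) =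
      ∫⁻ y, ENNReal.ofReal (gaussianConst n s) *
        (ENNReal.ofReal (Real.exp (-‖s⁻¹ • y - s⁻¹ • x‖ ^ 2 / 2)) * f y) := by
  have hφ := (continuous_gaussianDensity (E := EuclideanSpace ℝ (Fin n))).measurable
  set h : EuclideanSpace ℝ (Fin n) → ℝ≥0∞ := fun y =>
    ENNReal.ofReal (gaussianDensity (s⁻¹ • y - s⁻¹ • x)) * f y with hh
  have hhm : Measurable h := by
    refine Measurable.mul (Measurable.ennreal_ofReal (hφ.comp ?_)) hf
    fun_prop
  have h1 : ∫⁻ z, f (x + s • z) ∂(stdGaussian (EuclideanSpace ℝ (Fin n))) =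
      ∫⁻ z, h (x + s • z) := by
    have hf' : Measurable fun z => f (x + s • z) := hf.comp (by fun_prop)
    rw [stdGaussian_eq_withDensity,
      lintegral_withDensity_eq_lintegral_mul _ hφ.ennreal_ofReal hf']
    refine lintegral_congr fun z => ?_
    simp only [hh, Pi.mul_apply]
    congr 3
    rw [smul_add, smul_smul, inv_mul_cancel₀ hs.ne', one_smul, add_sub_cancel_left]
  have h2 : ∫⁻ z, h (x + s • z) = ∫⁻ y, h (x + y) ∂(Measure.map (s • ·) volume) := by
    have hh' : Measurable fun y => h (x + y) := hhm.comp (by fun_prop)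
    rw [lintegral_map hh' (measurable_const_smul s)]
  rw [h1, h2, Measure.map_addHaar_smul _ hs.ne', lintegral_smul_measure, smul_eq_mul,
    lintegral_add_left_eq_self, ← lintegral_const_mul _ hhm]
  refine lintegral_congr fun y => ?_
  simp only [hh, gaussianDensity, gaussianConst, finrank_euclideanSpace_fin]
  rw [ENNReal.ofReal_mul (abs_nonneg _), ENNReal.ofReal_mul (by positivity)]
  ring

omit [IsProbabilityMeasure p] in
lemma lintegral_noisyPair [SFinite p] (hs : 0 < s)
    {f : EuclideanSpace ℝ (Fin n) × EuclideanSpace ℝ (Fin n) → ℝ≥0∞} (hf : Measurable f) :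
    ∫⁻ w, f w ∂(noisyPair p s) = ∫⁻ x, (∫⁻ y, ENNReal.ofReal (gaussianConst n s) *
        (ENNReal.ofReal (Real.exp (-‖s⁻¹ • y - s⁻¹ • x‖ ^ 2 / 2)) * f (x, y))) ∂p := by
  rw [noisyPair, lintegral_map hf (by fun_prop), lintegral_prod _ (by fun_prop)]
  refine lintegral_congr fun x => ?_
  exact lintegral_stdGaussian_comp hs x (f := fun y => f (x, y)) (by fun_prop)

lemma ofReal_likelihood {E : Type*} [NormedAddCommGroup E] [InnerProductSpace ℝ E]
    [FiniteDimensional ℝ E] [MeasurableSpace E] [BorelSpace E] {q : Measure E}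
    [IsProbabilityMeasure q] (r : ℝ) (a : E) : ENNReal.ofReal (likelihood q r a) =
      ∫⁻ v, ENNReal.ofReal (Real.exp (-‖a - r • v‖ ^ 2 / 2)) ∂q :=
  ofReal_integral_eq_lintegral_ofReal (integrable_exp_sq r a)
    (ae_of_all _ fun _ => (Real.exp_pos _).le)

/-- Integration against `noisyPair p s` with the noisy variable on the outside: an unnormalised
form of Bayes' rule. -/
lemma lintegral_noisyPair_swap (hs : 0 < s)
    {f : EuclideanSpace ℝ (Fin n) × EuclideanSpace ℝ (Fin n) → ℝ≥0∞} (hf : Measurable f) :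
    ∫⁻ w, f w ∂(noisyPair p s) = ∫⁻ y, ENNReal.ofReal (gaussianConst n s) *
        ∫⁻ x, (ENNReal.ofReal (Real.exp (-‖s⁻¹ • y - s⁻¹ • x‖ ^ 2 / 2)) * f (x, y)) ∂p := by
  rw [lintegral_noisyPair hs hf, lintegral_lintegral_swap (Measurable.aemeasurable (by fun_prop))]
  refine lintegral_congr fun y => ?_
  rw [lintegral_const_mul _ (by fun_prop)]

/-- The density of the noisy marginal `p_s`. -/
noncomputable def noisyDensity (p : Measure (EuclideanSpace ℝ (Fin n))) (s : ℝ)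
    (y : EuclideanSpace ℝ (Fin n)) : ℝ :=
  gaussianConst n s * likelihood p s⁻¹ (s⁻¹ • y)

lemma noisyDensity_pos (hs : 0 < s) (y : EuclideanSpace ℝ (Fin n)) : 0 < noisyDensity p s y :=
  mul_pos (gaussianConst_pos hs) (likelihood_pos _ _)

lemma measurable_noisyDensity : Measurable (noisyDensity p s) :=
  ((measurable_likelihood s⁻¹).comp (by fun_prop)).const_mul _

lemma noisyMarginal_eq_withDensity (hs : 0 < s) :
    noisyMarginal p s = volume.withDensity fun y => ENNReal.ofReal (noisyDensity p s y) := by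
  refine Measure.ext_of_lintegral _ fun f hf => ?_
  rw [noisyMarginal, Measure.snd, lintegral_map hf measurable_snd,
    lintegral_noisyPair_swap hs (by fun_prop),
    lintegral_withDensity_eq_lintegral_mul _ measurable_noisyDensity.ennreal_ofReal hf]
  refine lintegral_congr fun y => ?_
  simp only
  rw [lintegral_mul_const _ (by fun_prop), Pi.mul_apply, noisyDensity,
    ENNReal.ofReal_mul (gaussianConst_pos hs).le, ofReal_likelihood, mul_assoc]

instance isProbabilityMeasure_noisyMarginal : IsProbabilityMeasure (noisyMarginal p s) := by
  unfold noisyMarginal; infer_instance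

lemma noisyMarginal_absolutelyContinuous (hs : 0 < s) : noisyMarginal p s ≪ volume := by
  rw [noisyMarginal_eq_withDensity hs]
  exact withDensity_absolutelyContinuous _ _

lemma absolutelyContinuous_noisyMarginal (hs : 0 < s) : volume ≪ noisyMarginal p s := by
  rw [noisyMarginal_eq_withDensity hs]
  exact withDensity_absolutelyContinuous' measurable_noisyDensity.ennreal_ofReal.aemeasurable
    (ae_of_all _ fun y => (ENNReal.ofReal_pos.2 (noisyDensity_pos hs y)).ne')

/-- The conditional laws of `x ∼ q` given `x_s = y`, as a Markov kernel. -/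
noncomputable def posteriorKernel (q : Measure (EuclideanSpace ℝ (Fin n)))
    [IsProbabilityMeasure q] (s : ℝ) :
    Kernel (EuclideanSpace ℝ (Fin n)) (EuclideanSpace ℝ (Fin n)) where
  toFun y := posterior q s⁻¹ (s⁻¹ • y)
  measurable' := by
    refine Measure.measurable_of_measurable_coe _ fun t ht => ?_
    simp_rw [posterior, tilted_apply' _ _ ht]
    have := measurable_likelihood (q := q) s⁻¹
    have h : Measurable fun w : EuclideanSpace ℝ (Fin n) × EuclideanSpace ℝ (Fin n) =>
        ENNReal.ofReal (Real.exp (-‖s⁻¹ • w.1 - s⁻¹ • w.2‖ ^ 2 / 2) /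
          likelihood q s⁻¹ (s⁻¹ • w.1)) := by fun_prop
    exact h.lintegral_prod_right'

instance isMarkovKernel_posteriorKernel : IsMarkovKernel (posteriorKernel q s) :=
  ⟨fun y => isProbabilityMeasure_posterior (q := q) s⁻¹ (s⁻¹ • y)⟩

/-- **Bayes' rule**: `posteriorKernel q s` disintegrates the joint law over the noisy marginal. -/
lemma map_swap_noisyPair (hs : 0 < s) :
    (noisyPair q s).map (fun w => (w.2, w.1)) = (noisyPair q s).map Prod.snd ⊗ₘ
      posteriorKernel q s := by
  refine Measure.ext_of_lintegral _ fun f hf => ?_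
  change _ = ∫⁻ w, f w ∂(noisyMarginal q s ⊗ₘ posteriorKernel q s)
  rw [lintegral_map hf (by fun_prop), lintegral_noisyPair_swap hs (by fun_prop),
    Measure.lintegral_compProd hf, noisyMarginal_eq_withDensity hs,
    lintegral_withDensity_eq_lintegral_mul _ measurable_noisyDensity.ennreal_ofReal
      hf.lintegral_kernel_prod_right']
  refine lintegral_congr fun y => ?_
  rw [Pi.mul_apply, noisyDensity, ENNReal.ofReal_mul (gaussianConst_pos hs).le, mul_assoc]
  congr 1
  change _ = _ * ∫⁻ x, f (y, x) ∂(posterior q s⁻¹ (s⁻¹ • y))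
  have hL := likelihood_pos (q := q) s⁻¹ (s⁻¹ • y)
  rw [posterior, lintegral_tilted, ← lintegral_const_mul _ (by fun_prop)]
  refine lintegral_congr fun x => ?_
  rw [← mul_assoc, ← ENNReal.ofReal_mul hL.le]
  congr 2
  exact (mul_div_cancel₀ _ hL.ne').symm

lemma condDistrib_noisyPair_ae_eq (hs : 0 < s) :
    ∀ᵐ y ∂(noisyMarginal q s), condDistrib Prod.fst Prod.snd (noisyPair q s) y =
      posterior q s⁻¹ (s⁻¹ • y) :=
  condDistrib_ae_eq_of_measure_eq_compProd (μ := noisyPair q s) Prod.snd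
    measurable_fst.aemeasurable (map_swap_noisyPair hs)

/-- The denoiser is the posterior mean almost everywhere for Lebesgue measure, hence also for the
noisy marginal of any other data law: `condDistrib` is determined only almost everywhere for the
noisy marginal of `q`, but this measure has a positive density. -/
lemma denoiser_ae_eq (hs : 0 < s) :
    ∀ᵐ y ∂(volume : Measure (EuclideanSpace ℝ (Fin n))),
      denoiser q s y = posteriorMean q s⁻¹ (s⁻¹ • y) := by
  refine (absolutelyContinuous_noisyMarginal (p := q) hs).ae_le ?_
  filter_upwards [condDistrib_noisyPair_ae_eq (q := q) hs] with y hy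
  rw [denoiser, hy, posteriorMean]

lemma ae_noisyPair_denoiser_eq (hs : 0 < s) :
    ∀ᵐ w ∂(noisyPair p s), denoiser q s w.2 = posteriorMean q s⁻¹ (s⁻¹ • w.2) := by
  have h := (noisyMarginal_absolutelyContinuous (p := p) hs).ae_le (denoiser_ae_eq (q := q) hs)
  exact ae_of_ae_map (f := Prod.snd) measurable_snd.aemeasurable h

lemma integrable_noisyPair_iff {f : EuclideanSpace ℝ (Fin n) × EuclideanSpace ℝ (Fin n) → ℝ}
    (hf : Measurable f) : Integrable f (noisyPair p s) ↔
      Integrable (fun w => f (w.1, w.1 + s • w.2))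
        (p.prod (stdGaussian (EuclideanSpace ℝ (Fin n)))) := by
  rw [noisyPair, integrable_map_measure hf.aestronglyMeasurable
    (Measurable.aemeasurable (by fun_prop))]
  rfl

lemma integral_noisyPair {f : EuclideanSpace ℝ (Fin n) × EuclideanSpace ℝ (Fin n) → ℝ}
    (hf : Measurable f) : ∫ w, f w ∂(noisyPair p s) =
      ∫ w, f (w.1, w.1 + s • w.2) ∂(p.prod (stdGaussian (EuclideanSpace ℝ (Fin n)))) := by
  rw [noisyPair, integral_map (Measurable.aemeasurable (by fun_prop)) hf.aestronglyMeasurable]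

lemma inv_smul_add_smul (hs : 0 < s) (x z : EuclideanSpace ℝ (Fin n)) :
    s⁻¹ • (x + s • z) = s⁻¹ • x + z := by
  rw [smul_add, smul_smul, inv_mul_cancel₀ hs.ne', one_smul]

lemma integrable_sq_norm_sub_denoiser (hp : MemLp id 2 p) (hq : MemLp id 2 q) (hs : 0 < s) :
    Integrable (fun w => ‖w.1 - denoiser q s w.2‖ ^ 2) (noisyPair p s) := by
  have hm := measurable_posteriorMean (q := q) s⁻¹
  have h := integrable_sq_norm_sub_posteriorMean hp hq (inv_pos.2 hs).ne'
  have h2 : Integrable (fun w => ‖w.1 - posteriorMean q s⁻¹ (s⁻¹ • w.2)‖ ^ 2) (noisyPair p s) := by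
    rw [integrable_noisyPair_iff (by fun_prop)]
    simpa only [inv_smul_add_smul hs] using h
  refine h2.congr ?_
  filter_upwards [ae_noisyPair_denoiser_eq (p := p) (q := q) hs] with w hw
  rw [hw]

lemma mse_denoiser (hs : 0 < s) : mse p s (denoiser q s) =
    ∫ w, ‖w.1 - posteriorMean q s⁻¹ (s⁻¹ • w.1 + w.2)‖ ^ 2
      ∂(p.prod (stdGaussian (EuclideanSpace ℝ (Fin n)))) := by
  have hm := measurable_posteriorMean (q := q) s⁻¹
  have h : mse p s (denoiser q s) =
      ∫ w, ‖w.1 - posteriorMean q s⁻¹ (s⁻¹ • w.2)‖ ^ 2 ∂(noisyPair p s) := by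
    refine integral_congr_ae ?_
    filter_upwards [ae_noisyPair_denoiser_eq (p := p) (q := q) hs] with w hw
    rw [hw]
  rw [h, integral_noisyPair (by fun_prop)]
  simp only [inv_smul_add_smul hs]

/-- The MMSE denoiser of `p` minimises the mean squared error: it does so given each `x_s`. -/
lemma mse_denoiser_self_le (hp : MemLp id 2 p) (hq : MemLp id 2 q) (hs : 0 < s) :
    mse p s (denoiser p s) ≤ mse p s (denoiser q s) := by
  have key : ∀ (q' : Measure (EuclideanSpace ℝ (Fin n))) [IsProbabilityMeasure q'],
      MemLp id 2 q' →
      Integrable (fun w => ‖w.2 - posteriorMean q' s⁻¹ (s⁻¹ • w.1)‖ ^ 2)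
        ((noisyPair p s).map Prod.snd ⊗ₘ posteriorKernel p s) ∧
      mse p s (denoiser q' s) = ∫ y, ∫ x, ‖x - posteriorMean q' s⁻¹ (s⁻¹ • y)‖ ^ 2
        ∂(posteriorKernel p s y) ∂((noisyPair p s).map Prod.snd) := by
    intro q' _ hq'
    have hm := measurable_posteriorMean (q := q') s⁻¹
    have hi : Integrable (fun w => ‖w.2 - posteriorMean q' s⁻¹ (s⁻¹ • w.1)‖ ^ 2)
        ((noisyPair p s).map Prod.snd ⊗ₘ posteriorKernel p s) := by
      rw [← map_swap_noisyPair hs, integrable_map_measure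
        (Measurable.aestronglyMeasurable (by fun_prop)) (Measurable.aemeasurable (by fun_prop))]
      refine (integrable_sq_norm_sub_denoiser (q := q') hp hq' hs).congr ?_
      filter_upwards [ae_noisyPair_denoiser_eq (p := p) (q := q') hs] with w hw
      simp [hw]
    refine ⟨hi, ?_⟩
    rw [← Measure.integral_compProd hi, ← map_swap_noisyPair hs, integral_map
      (Measurable.aemeasurable (by fun_prop)) (Measurable.aestronglyMeasurable (by fun_prop))]
    refine integral_congr_ae ?_
    filter_upwards [ae_noisyPair_denoiser_eq (p := p) (q := q') hs] with w hw
    rw [hw]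
  obtain ⟨hip, hep⟩ := key p hp
  obtain ⟨hiq, heq⟩ := key q hq
  rw [hep, heq]
  refine integral_mono hip.integral_compProd hiq.integral_compProd fun y => ?_
  change ∫ x, ‖x - posteriorMean p s⁻¹ (s⁻¹ • y)‖ ^ 2 ∂(posterior p s⁻¹ (s⁻¹ • y)) ≤
    ∫ x, ‖x - posteriorMean q s⁻¹ (s⁻¹ • y)‖ ^ 2 ∂(posterior p s⁻¹ (s⁻¹ • y))
  rw [integral_sq_sub_eq (memLp_posterior hp s⁻¹ (s⁻¹ • y)) (posteriorMean q s⁻¹ (s⁻¹ • y))]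
  exact le_add_of_nonneg_right (by positivity)

end Channel

section Divergence

variable {n : ℕ} {p q : Measure (EuclideanSpace ℝ (Fin n))} [IsProbabilityMeasure p]
  [IsProbabilityMeasure q] {s : ℝ}

lemma noisyMarginal_eq_withDensity_noisyMarginal (hs : 0 < s) :
    noisyMarginal p s = (noisyMarginal q s).withDensity fun y =>
      ENNReal.ofReal (likelihood p s⁻¹ (s⁻¹ • y) / likelihood q s⁻¹ (s⁻¹ • y)) := by
  have hmp := measurable_likelihood (q := p) s⁻¹
  have hmq := measurable_likelihood (q := q) s⁻¹
  rw [noisyMarginal_eq_withDensity hs, noisyMarginal_eq_withDensity hs, ← withDensity_mul _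
    measurable_noisyDensity.ennreal_ofReal (by fun_prop)]
  congr 1
  ext y
  have hL := likelihood_pos (q := q) s⁻¹ (s⁻¹ • y)
  rw [Pi.mul_apply, ← ENNReal.ofReal_mul (noisyDensity_pos hs y).le]
  unfold noisyDensity
  rw [mul_assoc, mul_div_cancel₀ _ hL.ne']

lemma llr_noisyMarginal_ae_eq (hs : 0 < s) :
    llr (noisyMarginal p s) (noisyMarginal q s) =ᵐ[noisyMarginal p s] fun y =>
      Real.log (likelihood p s⁻¹ (s⁻¹ • y)) - Real.log (likelihood q s⁻¹ (s⁻¹ • y)) := by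
  have hmp := measurable_likelihood (q := p) s⁻¹
  have hmq := measurable_likelihood (q := q) s⁻¹
  have h : (noisyMarginal p s).rnDeriv (noisyMarginal q s) =ᵐ[noisyMarginal q s] fun y =>
      ENNReal.ofReal (likelihood p s⁻¹ (s⁻¹ • y) / likelihood q s⁻¹ (s⁻¹ • y)) := by
    rw [noisyMarginal_eq_withDensity_noisyMarginal (p := p) (q := q) hs]
    exact Measure.rnDeriv_withDensity _ (by fun_prop)
  have hac : noisyMarginal p s ≪ noisyMarginal q s :=
    (noisyMarginal_absolutelyContinuous hs).trans (absolutelyContinuous_noisyMarginal hs)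
  filter_upwards [hac.ae_le h] with y hy
  have hLp := likelihood_pos (q := p) s⁻¹ (s⁻¹ • y)
  have hLq := likelihood_pos (q := q) s⁻¹ (s⁻¹ • y)
  rw [llr, hy, ENNReal.toReal_ofReal (by positivity), Real.log_div hLp.ne' hLq.ne']

/-- The divergence of the noisy marginals is finite, and it is the expected log-likelihood ratio of
the two models. -/
lemma klDiv_noisyMarginal (hp : MemLp id 2 p) (hq : MemLp id 2 q) (hs : 0 < s) :
    0 ≤ expectedLogLikelihood p p s⁻¹ - expectedLogLikelihood p q s⁻¹ ∧
    klDiv (noisyMarginal p s) (noisyMarginal q s) =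
      ENNReal.ofReal (expectedLogLikelihood p p s⁻¹ - expectedLogLikelihood p q s⁻¹) := by
  have hmp := measurable_likelihood (q := p) s⁻¹
  have hmq := measurable_likelihood (q := q) s⁻¹
  have hac : noisyMarginal p s ≪ noisyMarginal q s :=
    (noisyMarginal_absolutelyContinuous hs).trans (absolutelyContinuous_noisyMarginal hs)
  have hip := integrable_log_likelihood hp hp s⁻¹
  have hiq := integrable_log_likelihood hp hq s⁻¹
  have hint : Integrable (fun y => Real.log (likelihood p s⁻¹ (s⁻¹ • y)) -
      Real.log (likelihood q s⁻¹ (s⁻¹ • y))) (noisyMarginal p s) := by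
    rw [noisyMarginal, Measure.snd, integrable_map_measure
      (Measurable.aestronglyMeasurable (by fun_prop)) (by fun_prop)]
    refine (integrable_noisyPair_iff (by fun_prop)).2 ?_
    simp only [Function.comp_apply, inv_smul_add_smul hs]
    exact hip.sub hiq
  have hval : ∫ y, (Real.log (likelihood p s⁻¹ (s⁻¹ • y)) -
      Real.log (likelihood q s⁻¹ (s⁻¹ • y))) ∂(noisyMarginal p s) =
      expectedLogLikelihood p p s⁻¹ - expectedLogLikelihood p q s⁻¹ := by
    rw [noisyMarginal, Measure.snd, integral_map (by fun_prop)
      (Measurable.aestronglyMeasurable (by fun_prop)), integral_noisyPair (by fun_prop)]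
    simp only [inv_smul_add_smul hs]
    exact integral_sub hip hiq
  have hllr := llr_noisyMarginal_ae_eq (p := p) (q := q) hs
  have hill := (integrable_congr hllr).2 hint
  have h1 := integral_llr_add_sub_measure_univ_nonneg hac hill
  have h2 := klDiv_of_ac_of_integrable hac hill
  rw [integral_congr_ae hllr, hval] at h1 h2
  simp only [probReal_univ, add_sub_cancel_right] at h1 h2
  exact ⟨h1, h2⟩

/-- Data processing: adding noise does not increase the divergence. -/
lemma klDiv_noisyMarginal_le (s : ℝ) :
    klDiv (noisyMarginal p s) (noisyMarginal q s) ≤ klDiv p q := by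
  have h : ∀ p' : Measure (EuclideanSpace ℝ (Fin n)), IsProbabilityMeasure p' →
      noisyMarginal p' s =
        (p' ⊗ₘ Kernel.const _ (stdGaussian (EuclideanSpace ℝ (Fin n)))).map
          fun w => w.1 + s • w.2 := by
    intro p' _
    rw [noisyMarginal, noisyPair, Measure.snd, Measure.map_map (by fun_prop) (by fun_prop),
      Measure.compProd_const]
    rfl
  rw [h p inferInstance, h q inferInstance]
  exact (klDiv_map_le _ _ (by fun_prop)).trans (klDiv_compProd_left _ _ _).le

end Divergence

/-! ### The dual description of the divergence and the limit of small noise -/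

section Duality

variable {α : Type*} [MeasurableSpace α] {p q : Measure α} [IsProbabilityMeasure p]
  [IsProbabilityMeasure q]

lemma integrable_of_abs_le {μ : Measure α} [IsFiniteMeasure μ] {f : α → ℝ} (hf : Measurable f)
    {M : ℝ} (hM : ∀ x, |f x| ≤ M) : Integrable f μ :=
  Integrable.of_bound hf.aestronglyMeasurable M (ae_of_all _ hM)

lemma integrable_exp_sub_one_of_abs_le {μ : Measure α} [IsFiniteMeasure μ] {f : α → ℝ}
    (hf : Measurable f) {M : ℝ} (hM : ∀ x, |f x| ≤ M) :
    Integrable (fun x => Real.exp (f x) - 1) μ := by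
  refine (integrable_of_abs_le (f := fun x => Real.exp (f x)) (by fun_prop) (M := Real.exp M)
    fun x => ?_).sub (integrable_const 1)
  rw [abs_of_pos (Real.exp_pos _)]
  exact Real.exp_le_exp.2 ((le_abs_self _).trans (hM x))

/-- The Fenchel–Young inequality for `klFun`, whose conjugate is `t ↦ exp t - 1`. -/
lemma mul_sub_exp_le_klFun {ρ : ℝ} (hρ : 0 ≤ ρ) (t : ℝ) :
    ρ * t - (Real.exp t - 1) ≤ klFun ρ := by
  rcases hρ.eq_or_lt with rfl | h
  · simpa [klFun_zero] using (Real.exp_pos t).le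
  · have h1 := Real.add_one_le_exp (t - Real.log ρ)
    have h2 : Real.exp t = ρ * Real.exp (t - Real.log ρ) := by
      rw [Real.exp_sub, Real.exp_log h]; field_simp
    rw [klFun_apply, h2]
    nlinarith

/-- The easy half of the dual description of the divergence: every bounded function gives a lower
bound. -/
lemma integral_sub_integral_exp_le_klDiv {f : α → ℝ} (hf : Measurable f) {M : ℝ}
    (hM : ∀ x, |f x| ≤ M) :
    ENNReal.ofReal (∫ x, f x ∂p - ∫ x, (Real.exp (f x) - 1) ∂q) ≤ klDiv p q := by
  by_cases h : klDiv p q = ∞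
  · simp [h]
  obtain ⟨hac, hint⟩ := klDiv_ne_top_iff.1 h
  refine ENNReal.ofReal_le_of_le_toReal ?_
  rw [toReal_klDiv_eq_integral_klFun hac, ← integral_rnDeriv_smul hac]
  have hif : Integrable (fun x => (p.rnDeriv q x).toReal • f x) q :=
    (integrable_rnDeriv_smul_iff hac).2 (integrable_of_abs_le hf hM)
  have hie := integrable_exp_sub_one_of_abs_le (μ := q) hf hM
  rw [← integral_sub hif hie]
  refine integral_mono (hif.sub hie) ((integrable_klFun_rnDeriv_iff hac).2 hint) fun x => ?_
  exact mul_sub_exp_le_klFun ENNReal.toReal_nonneg (f x)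

/-- For a density value `ρ ≥ 0`, the test value `log (max e⁻ᵏ (min ρ eᵏ))` is a bounded
approximation of the optimal `log ρ`. It is an improvement over the test value `0`. -/
lemma clamp_value_nonneg {ρ : ℝ} (hρ : 0 ≤ ρ) {k : ℝ} (hk : 0 ≤ k) :
    0 ≤ ρ * Real.log (max (Real.exp (-k)) (min ρ (Real.exp k)))
      - (max (Real.exp (-k)) (min ρ (Real.exp k)) - 1) := by
  have hb : 1 ≤ Real.exp k := Real.one_le_exp hk
  have ha : Real.exp (-k) ≤ 1 := Real.exp_le_one_iff.2 (by linarith)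
  rcases le_total ρ (Real.exp k) with h1 | h1
  · rw [min_eq_left h1]
    rcases le_total (Real.exp (-k)) ρ with h2 | h2
    · rw [max_eq_right h2]
      have := klFun_nonneg hρ
      rw [klFun_apply] at this
      linarith
    · rw [max_eq_left h2]
      have := klFun_nonneg (Real.exp_pos (-k)).le
      rw [klFun_apply] at this
      rw [Real.log_exp] at this ⊢
      nlinarith
  · rw [min_eq_right h1, max_eq_right (ha.trans hb)]
    have := klFun_nonneg (Real.exp_pos k).le
    rw [klFun_apply] at this
    rw [Real.log_exp] at this ⊢
    nlinarith

lemma tendsto_clamp_value {ρ : ℝ} (hρ : 0 ≤ ρ) :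
    Tendsto (fun k : ℕ => ρ * Real.log (max (Real.exp (-k)) (min ρ (Real.exp k)))
      - (max (Real.exp (-k)) (min ρ (Real.exp k)) - 1)) atTop (𝓝 (klFun ρ)) := by
  have hexp : Tendsto (fun k : ℕ => Real.exp (-(k : ℝ))) atTop (𝓝 0) :=
    Real.tendsto_exp_neg_atTop_nhds_zero.comp tendsto_natCast_atTop_atTop
  rcases hρ.eq_or_lt with rfl | h
  · have e : ∀ k : ℕ, (0 : ℝ) * Real.log (max (Real.exp (-k)) (min 0 (Real.exp k)))
        - (max (Real.exp (-k)) (min 0 (Real.exp k)) - 1) = 1 - Real.exp (-(k : ℝ)) := by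
      intro k
      rw [min_eq_left (Real.exp_pos _).le, max_eq_left (Real.exp_pos _).le]
      ring
    simp_rw [e]
    simpa [klFun_zero] using hexp.const_sub 1
  · refine tendsto_const_nhds.congr' ?_
    filter_upwards [hexp.eventually_le_const h, (Real.tendsto_exp_atTop.comp
      tendsto_natCast_atTop_atTop).eventually_ge_atTop ρ] with k h1 h2
    simp only [Function.comp_apply] at h2
    rw [min_eq_left h2, max_eq_right h1, klFun_apply]
    ring

/-- The hard half of the dual description of the divergence: bounded functions suffice to recover
it. -/
lemma klDiv_le_of_forall_measurable {C : ℝ}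
    (hC : ∀ f : α → ℝ, Measurable f → ∀ M : ℝ, (∀ x, |f x| ≤ M) →
      ∫ x, f x ∂p - ∫ x, (Real.exp (f x) - 1) ∂q ≤ C) :
    klDiv p q ≤ ENNReal.ofReal C := by
  -- large multiples of the indicator of a `q`-null set force it to be `p`-null
  have hac : p ≪ q := by
    refine Measure.AbsolutelyContinuous.mk fun A hA hqA => ?_
    have h1 : ∀ k : ℕ, (k : ℝ) * p.real A ≤ C := by
      intro k
      have h2 := hC (A.indicator fun _ => (k : ℝ)) (measurable_const.indicator hA) k fun x => by
        by_cases hx : x ∈ A <;> simp [hx]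
      have h3 : ∫ x, (Real.exp (A.indicator (fun _ => (k : ℝ)) x) - 1) ∂q = 0 := by
        refine integral_eq_zero_of_ae ?_
        have : ∀ᵐ x ∂q, x ∉ A := measure_eq_zero_iff_ae_notMem.1 hqA
        filter_upwards [this] with x hx
        simp [hx]
      rw [h3, integral_indicator_const _ hA, smul_eq_mul] at h2
      linarith
    by_contra hne
    have hpos : 0 < p.real A := by
      rw [measureReal_def]
      exact ENNReal.toReal_pos hne (measure_ne_top _ _)
    obtain ⟨k, hk⟩ := exists_nat_gt (C / p.real A)
    rw [div_lt_iff₀ hpos] at hk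
    linarith [h1 k]
  rw [klDiv_eq_lintegral_klFun_of_ac hac]
  set ρ : α → ℝ := fun x => (p.rnDeriv q x).toReal
  have hρ0 : ∀ x, 0 ≤ ρ x := fun x => ENNReal.toReal_nonneg
  have hρm : Measurable ρ := by fun_prop
  set g : ℕ → α → ℝ := fun k x => max (Real.exp (-k)) (min (ρ x) (Real.exp k))
  have hgpos : ∀ k x, 0 < g k x := fun k x => lt_max_of_lt_left (Real.exp_pos _)
  have hgm : ∀ k, Measurable (g k) := fun k => by fun_prop
  have hgb : ∀ k x, |Real.log (g k x)| ≤ (k : ℝ) := by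
    intro k x
    refine abs_le.2 ⟨?_, ?_⟩
    · rw [Real.le_log_iff_exp_le (hgpos k x)]
      exact le_max_left _ _
    · rw [Real.log_le_iff_le_exp (hgpos k x)]
      exact max_le (Real.exp_le_exp.2 (by linarith [Nat.cast_nonneg (α := ℝ) k])) (min_le_right _ _)
  set V : ℕ → α → ℝ := fun k x => ρ x * Real.log (g k x) - (g k x - 1)
  have hVm : ∀ k, Measurable (V k) := fun k => by fun_prop
  have hbound : ∀ k, ∫⁻ x, ENNReal.ofReal (V k x) ∂q ≤ ENNReal.ofReal C := by
    intro k
    have hlm : Measurable fun x => Real.log (g k x) := by fun_prop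
    have hi1 : Integrable (fun x => ρ x • Real.log (g k x)) q :=
      (integrable_rnDeriv_smul_iff hac).2 (integrable_of_abs_le hlm (hgb k))
    have hi2 := integrable_exp_sub_one_of_abs_le (μ := q) hlm (hgb k)
    have h1 := hC (fun x => Real.log (g k x)) hlm k (hgb k)
    rw [← integral_rnDeriv_smul hac, ← integral_sub hi1 hi2] at h1
    simp_rw [Real.exp_log (hgpos k _)] at h1 hi2
    have hVi : Integrable (V k) q := hi1.sub hi2
    rw [← ofReal_integral_eq_lintegral_ofReal hVi
      (ae_of_all _ fun x => clamp_value_nonneg (hρ0 x) (Nat.cast_nonneg k))]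
    exact ENNReal.ofReal_le_ofReal h1
  -- the test values `log (g k)` are optimal in the limit, and Fatou's lemma applies
  calc ∫⁻ x, ENNReal.ofReal (klFun (ρ x)) ∂q
      = ∫⁻ x, liminf (fun k => ENNReal.ofReal (V k x)) atTop ∂q := by
        refine lintegral_congr fun x => ?_
        exact ((ENNReal.continuous_ofReal.tendsto _).comp
          (tendsto_clamp_value (hρ0 x))).liminf_eq.symm
    _ ≤ liminf (fun k => ∫⁻ x, ENNReal.ofReal (V k x) ∂q) atTop :=
        lintegral_liminf_le fun k => (hVm k).ennreal_ofReal
    _ ≤ ENNReal.ofReal C :=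
        liminf_le_of_frequently_le' (Frequently.of_forall hbound)

end Duality

section Continuous

variable {X : Type*} [TopologicalSpace X] [NormalSpace X] [MeasurableSpace X] [BorelSpace X]
  {p q : Measure X} [IsProbabilityMeasure p] [IsProbabilityMeasure q]
  [(p + q).WeaklyRegular]

/-- In the dual description of the divergence, bounded continuous functions suffice, by density in
`L¹(p + q)`. -/
lemma klDiv_le_of_forall_continuous {C : ℝ}
    (hC : ∀ f : X → ℝ, Continuous f → ∀ M : ℝ, (∀ x, |f x| ≤ M) →
      ∫ x, f x ∂p - ∫ x, (Real.exp (f x) - 1) ∂q ≤ C) :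
    klDiv p q ≤ ENNReal.ofReal C := by
  refine klDiv_le_of_forall_measurable fun f hf M hM => ?_
  refine le_of_forall_pos_le_add fun δ hδ => ?_
  set ε := δ / (1 + Real.exp M) with hε
  have hε0 : 0 < ε := by positivity
  obtain ⟨g, hg, hgi⟩ := (integrable_of_abs_le (μ := p + q) hf
    hM).exists_boundedContinuous_integral_sub_le hε0
  -- truncation restores the bound `M`, which controls the Lipschitz constant of `exp`
  set g' : X → ℝ := fun x => max (-M) (min (g x) M) with hg'
  have hg'c : Continuous g' := by fun_prop
  by_cases hne : Nonempty X
  swap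
  · exact absurd (inferInstance : IsProbabilityMeasure p).ne_zero
      (by rw [not_nonempty_iff] at hne; simp [Measure.eq_zero_of_isEmpty p])
  have hM0 : 0 ≤ M := (abs_nonneg _).trans (hM hne.some)
  have hg'M : ∀ x, |g' x| ≤ M := fun x => abs_le.2
    ⟨le_max_left _ _, max_le (by linarith) (min_le_right _ _)⟩
  have hdist : ∀ x, |f x - g' x| ≤ ‖f x - g x‖ := by
    intro x
    obtain ⟨h1, h2⟩ := abs_le.1 (hM x)
    rw [Real.norm_eq_abs]
    rcases le_total (g x) M with h3 | h3
    · simp only [hg', min_eq_left h3]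
      rcases le_total (-M) (g x) with h4 | h4
      · rw [max_eq_right h4]
      · rw [max_eq_left h4, abs_of_nonneg (by linarith), abs_of_nonneg (by linarith)]
        linarith
    · simp only [hg', min_eq_right h3]
      rw [max_eq_right (by linarith), abs_of_nonpos (by linarith), abs_of_nonpos (by linarith)]
      linarith
  have hgp := integrable_of_abs_le (μ := p) hg'c.measurable hg'M
  have hd : Integrable (fun x => ‖f x - g x‖) (p + q) :=
    ((integrable_of_abs_le (μ := p + q) hf hM).sub hgi).norm
  rw [integral_add_measure hd.left_of_add_measure hd.right_of_add_measure] at hg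
  have hq0 : 0 ≤ ∫ x, ‖f x - g x‖ ∂q := integral_nonneg fun _ => norm_nonneg _
  have hp0 : 0 ≤ ∫ x, ‖f x - g x‖ ∂p := integral_nonneg fun _ => norm_nonneg _
  have h1 : ∫ x, f x ∂p ≤ ∫ x, g' x ∂p + ∫ x, ‖f x - g x‖ ∂p := by
    rw [← integral_add hgp hd.left_of_add_measure]
    refine integral_mono (integrable_of_abs_le hf hM)
      (hgp.add hd.left_of_add_measure) fun x => ?_
    have := (le_abs_self _).trans (hdist x)
    simp only
    linarith
  have h2 : ∫ x, (Real.exp (g' x) - 1) ∂q ≤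
      ∫ x, (Real.exp (f x) - 1) ∂q + Real.exp M * ∫ x, ‖f x - g x‖ ∂q := by
    have hie := integrable_exp_sub_one_of_abs_le (μ := q) hf hM
    have hn := hd.right_of_add_measure.const_mul (Real.exp M)
    rw [← integral_const_mul, ← integral_add hie hn]
    refine integral_mono (integrable_exp_sub_one_of_abs_le hg'c.measurable hg'M)
      (hie.add hn) fun x => ?_
    simp only
    have h3 := Real.add_one_le_exp (f x - g' x)
    have h4 : Real.exp (f x) = Real.exp (g' x) * Real.exp (f x - g' x) := by
      rw [← Real.exp_add]; congr 1; ring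
    have h5 : Real.exp (g' x) ≤ Real.exp M := Real.exp_le_exp.2 ((abs_le.1 (hg'M x)).2)
    have h6 := (neg_le_abs _).trans (hdist x)
    have h7 : Real.exp (g' x) * (-(f x - g' x)) ≤ Real.exp M * ‖f x - g x‖ :=
      (mul_le_mul_of_nonneg_left h6 (Real.exp_pos _).le).trans
        (mul_le_mul_of_nonneg_right h5 (norm_nonneg _))
    nlinarith [Real.exp_pos (g' x)]
  have h3 := hC g' hg'c M hg'M
  have h4 : (1 + Real.exp M) * ε = δ := by rw [hε]; field_simp
  nlinarith [Real.exp_pos M]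

end Continuous

section SmallNoise

variable {n : ℕ} {p q : Measure (EuclideanSpace ℝ (Fin n))} [IsProbabilityMeasure p]
  [IsProbabilityMeasure q]

lemma integral_noisyMarginal {f : EuclideanSpace ℝ (Fin n) → ℝ} (hf : Measurable f) (s : ℝ) :
    ∫ y, f y ∂(noisyMarginal p s) =
      ∫ w, f (w.1 + s • w.2) ∂(p.prod (stdGaussian (EuclideanSpace ℝ (Fin n)))) := by
  rw [noisyMarginal, Measure.snd, integral_map (by fun_prop) hf.aestronglyMeasurable,
    integral_noisyPair (by fun_prop)]

lemma tendsto_integral_noisyMarginal {f : EuclideanSpace ℝ (Fin n) → ℝ} (hf : Continuous f)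
    {M : ℝ} (hM : ∀ x, |f x| ≤ M) :
    Tendsto (fun s => ∫ y, f y ∂(noisyMarginal p s)) (𝓝 0) (𝓝 (∫ x, f x ∂p)) := by
  simp_rw [integral_noisyMarginal hf.measurable]
  have h : Continuous fun s : ℝ => ∫ w, f (w.1 + s • w.2)
      ∂(p.prod (stdGaussian (EuclideanSpace ℝ (Fin n)))) := by
    refine continuous_of_dominated (bound := fun _ => M)
      (fun s => Continuous.aestronglyMeasurable (by fun_prop)) (fun s => ae_of_all _ fun w => hM _)
      (integrable_const _) (ae_of_all _ fun w => by fun_prop)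
  have h0 := h.tendsto 0
  simp only [zero_smul, add_zero] at h0
  rwa [integral_fun_fst (μ := p) f, probReal_univ, one_smul] at h0

/-- Lower semicontinuity of the divergence as the noise disappears. -/
lemma klDiv_le_of_eventually_noisyMarginal_le {ι : Type*} {l : Filter ι} [l.NeBot] {σ : ι → ℝ}
    (hσ : Tendsto σ l (𝓝 0)) {C : ℝ≥0∞}
    (hC : ∀ᶠ t in l, klDiv (noisyMarginal p (σ t)) (noisyMarginal q (σ t)) ≤ C) :
    klDiv p q ≤ C := by
  rcases eq_or_ne C ∞ with rfl | hCtop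
  · exact le_top
  rw [← ENNReal.ofReal_toReal hCtop]
  refine klDiv_le_of_forall_continuous fun f hf M hM => ?_
  have hf1 : ∀ x, |Real.exp (f x) - 1| ≤ Real.exp M + 1 := by
    intro x
    refine (abs_sub _ _).trans ?_
    rw [abs_of_pos (Real.exp_pos _), abs_one]
    have := Real.exp_le_exp.2 ((le_abs_self _).trans (hM x))
    linarith
  have h1 := (tendsto_integral_noisyMarginal (p := p) hf hM).comp hσ
  have h2 := (tendsto_integral_noisyMarginal (p := q) (f := fun x => Real.exp (f x) - 1)
    (by fun_prop) hf1).comp hσ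
  refine le_of_tendsto (h1.sub h2) ?_
  filter_upwards [hC] with t ht
  have h3 := (integral_sub_integral_exp_le_klDiv (p := noisyMarginal p (σ t))
    (q := noisyMarginal q (σ t)) hf.measurable hM).trans ht
  exact (ENNReal.ofReal_le_iff_le_toReal hCtop).1 h3

end SmallNoise

/-! ### Noise schedules -/

section Schedule

lemma isOpen_times (T : EReal) : IsOpen (times T) :=
  isOpen_Ioi.inter (isOpen_Iio.preimage continuous_coe_real_ereal)

lemma Ioc_subset_times {T : EReal} {S : ℝ} (hS : S ∈ times T) : Ioc 0 S ⊆ times T :=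
  fun _ ht => ⟨ht.1, (EReal.coe_le_coe_iff.2 ht.2).trans_lt hS.2⟩

lemma IsNoiseSchedule.deriv_nonneg {T : EReal} {σ : ℝ → ℝ} (hσ : IsNoiseSchedule T σ) {t : ℝ}
    (ht : t ∈ times T) : 0 ≤ deriv σ t := by
  rw [← derivWithin_of_isOpen (isOpen_times T) ht]
  exact hσ.monotoneOn.derivWithin_nonneg

variable {J e : ℝ → ℝ} {T : EReal} {σ : ℝ → ℝ} {κ : ℝ≥0∞}

/-- The fundamental theorem of calculus for `J ∘ σ`. The derivative has a sign, so that it is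
integrable without any further hypothesis. -/
lemma ofReal_comp_schedule_eq (hJ : ∀ s, 0 < s → HasDerivAt J (-(e s * s ^ (-3 : ℤ))) s)
    (he : ∀ s, 0 < s → 0 ≤ e s) (hJ0 : ∀ s, 0 < s → 0 ≤ J s) (hσ : IsNoiseSchedule T σ)
    {a S : ℝ} (ha : 0 < a) (haS : a ≤ S) (hS : S ∈ times T) :
    ENNReal.ofReal (J (σ a)) = ENNReal.ofReal (J (σ S)) +
      ∫⁻ t in Ioc a S, ENNReal.ofReal (e (σ t) * σ t ^ (-3 : ℤ) * deriv σ t) := by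
  have hsub : Icc a S ⊆ times T := fun t ht => Ioc_subset_times hS ⟨ha.trans_le ht.1, ht.2⟩
  have hd : ∀ t ∈ Icc a S, HasDerivAt (fun t => -J (σ t))
      (e (σ t) * σ t ^ (-3 : ℤ) * deriv σ t) t := by
    intro t ht
    have h1 := (hJ (σ t) (hσ.pos t (hsub ht))).comp t
      (hσ.differentiableAt t (hsub ht)).hasDerivAt
    refine h1.neg.congr_deriv ?_
    ring
  have hnn : ∀ t ∈ Icc a S, 0 ≤ e (σ t) * σ t ^ (-3 : ℤ) * deriv σ t := fun t ht =>
    mul_nonneg (mul_nonneg (he _ (hσ.pos t (hsub ht)))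
      (zpow_pos (hσ.pos t (hsub ht)) _).le) (hσ.deriv_nonneg (hsub ht))
  have hint : IntegrableOn (fun t => e (σ t) * σ t ^ (-3 : ℤ) * deriv σ t) (Ioc a S) :=
    intervalIntegral.integrableOn_deriv_of_nonneg
      (fun t ht => (hd t ht).continuousAt.continuousWithinAt)
      (fun t ht => hd t (Ioo_subset_Icc_self ht)) fun t ht => hnn t (Ioo_subset_Icc_self ht)
  have hftc := intervalIntegral.integral_eq_sub_of_hasDerivAt
    (fun t ht => hd t (by rwa [uIcc_of_le haS] at ht))
    ((intervalIntegrable_iff_integrableOn_Ioc_of_le haS).2 hint)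
  rw [intervalIntegral.integral_of_le haS] at hftc
  have hae : 0 ≤ᵐ[volume.restrict (Ioc a S)]
      fun t => e (σ t) * σ t ^ (-3 : ℤ) * deriv σ t := by
    filter_upwards [ae_restrict_mem measurableSet_Ioc] with t ht
    exact hnn t (Ioc_subset_Icc_self ht)
  rw [← ofReal_integral_eq_lintegral_ofReal hint hae, hftc, ← ENNReal.ofReal_add
    (hJ0 _ (hσ.pos S hS)) (hftc ▸ integral_nonneg_of_ae hae)]
  congr 1
  ring

lemma setLIntegral_Ioc_zero_eq_iSup (f : ℝ → ℝ≥0∞) (S : ℝ) :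
    ∫⁻ t in Ioc 0 S, f t = ⨆ a : {a : ℚ // 0 < a}, ∫⁻ t in Ioc (a : ℝ) S, f t := by
  have hU : Ioc 0 S = ⋃ a : {a : ℚ // 0 < a}, Ioc ((a : ℚ) : ℝ) S := by
    ext t
    simp only [mem_iUnion, mem_Ioc, Subtype.exists, exists_prop]
    constructor
    · rintro ⟨h0, h1⟩
      obtain ⟨a, ha0, hat⟩ := exists_rat_btwn h0
      exact ⟨a, by exact_mod_cast ha0, hat, h1⟩
    · rintro ⟨a, ha0, hat, h1⟩
      exact ⟨lt_trans (by exact_mod_cast ha0) hat, h1⟩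
  rw [hU, setLIntegral_iUnion_of_directed]
  exact directed_of_isDirected_ge fun a b hab => Ioc_subset_Ioc_left (by exact_mod_cast hab)

lemma setLIntegral_times_eq_iSup (f : ℝ → ℝ≥0∞) (T : EReal) :
    ∫⁻ t in times T, f t =
      ⨆ S : {S : ℚ // (S : ℝ) ∈ times T}, ∫⁻ t in Ioo 0 ((S : ℚ) : ℝ), f t := by
  have hU : times T = ⋃ S : {S : ℚ // (S : ℝ) ∈ times T}, Ioo 0 ((S : ℚ) : ℝ) := by
    ext t
    simp only [mem_iUnion, mem_Ioo, Subtype.exists, exists_prop]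
    constructor
    · rintro ⟨h0, h1⟩
      obtain ⟨S, hS1, hS2⟩ := EReal.lt_iff_exists_rat_btwn.1 h1
      have hS1' : t < S := by exact_mod_cast hS1
      exact ⟨S, ⟨h0.trans hS1', by exact_mod_cast hS2⟩, h0, hS1'⟩
    · rintro ⟨S, hS, h0, h1⟩
      exact Ioc_subset_times hS ⟨h0, h1.le⟩
  conv_lhs => rw [hU]
  rw [setLIntegral_iUnion_of_directed]
  exact directed_of_isDirected_le fun a b hab => Ioo_subset_Ioo_right (by exact_mod_cast hab)

/-- The identity up to a time `S`, for the limit `κ` of `J` at zero noise, which may be infinite: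
`hle` bounds `J` by `κ`, and `hlsc` is the lower semicontinuity of `J ∘ σ` at time `0`. -/
lemma eq_ofReal_add_setLIntegral (hJ : ∀ s, 0 < s → HasDerivAt J (-(e s * s ^ (-3 : ℤ))) s)
    (he : ∀ s, 0 < s → 0 ≤ e s) (hJ0 : ∀ s, 0 < s → 0 ≤ J s)
    (hle : ∀ s, 0 < s → ENNReal.ofReal (J s) ≤ κ) (hσ : IsNoiseSchedule T σ)
    (hlsc : ∀ C, (∀ᶠ t in 𝓝[>] 0, ENNReal.ofReal (J (σ t)) ≤ C) → κ ≤ C)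
    {S : ℝ} (hS : S ∈ times T) :
    κ = ENNReal.ofReal (J (σ S)) +
      ∫⁻ t in Ioo 0 S, ENNReal.ofReal (e (σ t) * σ t ^ (-3 : ℤ) * deriv σ t) := by
  rw [restrict_Ioo_eq_restrict_Ioc]
  refine le_antisymm (hlsc _ ?_) ?_
  · filter_upwards [Ioo_mem_nhdsGT hS.1] with t ht
    rw [ofReal_comp_schedule_eq hJ he hJ0 hσ ht.1 ht.2.le hS]
    gcongr
    exact ht.1.le
  · rw [setLIntegral_Ioc_zero_eq_iSup]
    have : Nonempty {a : ℚ // 0 < a} := ⟨1, one_pos⟩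
    rw [ENNReal.add_iSup]
    refine iSup_le fun a => ?_
    have ha0 : (0 : ℝ) < (a : ℚ) := by exact_mod_cast a.2
    rcases le_total ((a : ℚ) : ℝ) S with haS | haS
    · rw [← ofReal_comp_schedule_eq hJ he hJ0 hσ ha0 haS hS]
      exact hle _ (hσ.pos _ (Ioc_subset_times hS ⟨ha0, haS⟩))
    · rw [Ioc_eq_empty (not_lt.2 haS)]
      simpa using hle _ (hσ.pos S hS)

/-- The identity up to the horizon `T`, when the noise is unbounded and `J` vanishes at infinite
noise. -/
lemma eq_setLIntegral_times (hJlim : Tendsto J atTop (𝓝 0)) {f : ℝ → ℝ≥0∞}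
    (hS : ∀ S ∈ times T, κ = ENNReal.ofReal (J (σ S)) + ∫⁻ t in Ioo 0 S, f t)
    (hσ : ¬ BddAbove (σ '' times T)) : κ = ∫⁻ t in times T, f t := by
  refine le_antisymm ?_ ?_
  · refine ENNReal.le_of_forall_pos_le_add fun ε hε _ => ?_
    obtain ⟨b, hb⟩ := eventually_atTop.1 (hJlim.eventually_lt_const (NNReal.coe_pos.2 hε))
    obtain ⟨_, ⟨S, hST, rfl⟩, hbS⟩ := not_bddAbove_iff.1 hσ b
    rw [hS S hST, add_comm]
    gcongr
    · exact fun t ht => Ioc_subset_times hST (Ioo_subset_Ioc_self ht)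
    · rw [← ENNReal.ofReal_coe_nnreal]
      exact ENNReal.ofReal_le_ofReal (hb _ hbS.le).le
  · rw [setLIntegral_times_eq_iSup]
    refine iSup_le fun S => ?_
    rw [hS _ S.2]
    exact le_add_self

end Schedule

section Main

variable {n : ℕ} {p q : Measure (EuclideanSpace ℝ (Fin n))} [IsProbabilityMeasure p]
  [IsProbabilityMeasure q]

/-- The I-MMSE relation in terms of the noise level `s = 1 / r`. -/
lemma hasDerivAt_expectedLogLikelihood_sub (hp : MemLp id 2 p) (hq : MemLp id 2 q) {s : ℝ}
    (hs : 0 < s) :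
    HasDerivAt (fun s => expectedLogLikelihood p p s⁻¹ - expectedLogLikelihood p q s⁻¹)
      (-(excessError p q s * s ^ (-3 : ℤ))) s := by
  have hr : 0 < s⁻¹ := inv_pos.2 hs
  have hinv := hasDerivAt_inv hs.ne'
  have h := ((hasDerivAt_expectedLogLikelihood hp hp hr).comp s hinv).sub
    ((hasDerivAt_expectedLogLikelihood hp hq hr).comp s hinv)
  refine h.congr_deriv ?_
  rw [excessError, mse_denoiser hs, mse_denoiser hs, zpow_neg]
  generalize ∫ w, ‖w.1 - posteriorMean p s⁻¹ (s⁻¹ • w.1 + w.2)‖ ^ 2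
      ∂(p.prod (stdGaussian (EuclideanSpace ℝ (Fin n)))) = A
  generalize ∫ w, ‖w.1 - posteriorMean q s⁻¹ (s⁻¹ • w.1 + w.2)‖ ^ 2
      ∂(p.prod (stdGaussian (EuclideanSpace ℝ (Fin n)))) = B
  have : s ^ (3 : ℤ) = s ^ 3 := by norm_cast
  rw [this]
  field_simp
  ring

lemma klDiv_eq_add_setLIntegral (hp : MemLp id 2 p) (hq : MemLp id 2 q) {T : EReal} {σ : ℝ → ℝ}
    (hσ : IsNoiseSchedule T σ) {S : ℝ} (hS : S ∈ times T) :
    klDiv p q = klDiv (noisyMarginal p (σ S)) (noisyMarginal q (σ S)) +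
      ∫⁻ t in Ioo 0 S, ENNReal.ofReal (excessError p q (σ t) * σ t ^ (-3 : ℤ) * deriv σ t) := by
  rw [(klDiv_noisyMarginal hp hq (hσ.pos S hS)).2]
  refine eq_ofReal_add_setLIntegral (fun s hs => hasDerivAt_expectedLogLikelihood_sub hp hq hs)
    (fun s hs => sub_nonneg.2 (mse_denoiser_self_le hp hq hs))
    (fun s hs => (klDiv_noisyMarginal hp hq hs).1) (fun s hs => ?_) hσ (fun C hC => ?_) hS
  · rw [← (klDiv_noisyMarginal hp hq hs).2]
    exact klDiv_noisyMarginal_le s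
  · refine klDiv_le_of_eventually_noisyMarginal_le hσ.tendsto_zero ?_
    filter_upwards [hC, Ioo_mem_nhdsGT hS.1] with t ht htS
    rw [(klDiv_noisyMarginal hp hq
      (hσ.pos t (Ioc_subset_times hS (Ioo_subset_Ioc_self htS)))).2]
    exact ht

lemma klDiv_eq_setLIntegral_times (hp : MemLp id 2 p) (hq : MemLp id 2 q) {T : EReal}
    {σ : ℝ → ℝ} (hσ : IsNoiseSchedule T σ) (hunb : ¬ BddAbove (σ '' times T)) :
    klDiv p q = ∫⁻ t in times T,
      ENNReal.ofReal (excessError p q (σ t) * σ t ^ (-3 : ℤ) * deriv σ t) := by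
  refine eq_setLIntegral_times (tendsto_expectedLogLikelihood_sub hp hq) (fun S hS => ?_) hunb
  rw [← (klDiv_noisyMarginal hp hq (hσ.pos S hS)).2]
  exact klDiv_eq_add_setLIntegral hp hq hσ hS

lemma times_top : times ⊤ = Ioi 0 := by
  ext t
  simp [times, EReal.coe_lt_top]

lemma isNoiseSchedule_id : IsNoiseSchedule ⊤ fun t : ℝ => t where
  pos _ ht := ht.1
  monotoneOn := monotone_id.monotoneOn _
  differentiableAt _ _ := differentiableAt_id
  tendsto_zero := tendsto_id.mono_left nhdsWithin_le_nhds

end Main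

end Denoising

theorem proposition1 {n : ℕ} (p q : Measure (EuclideanSpace ℝ (Fin n)))
    [IsProbabilityMeasure p] [IsProbabilityMeasure q]
    (hp : MemLp id 2 p) (hq : MemLp id 2 q) :
    -- the errors are finite at every noise level, and the excess is nonnegative
    (∀ s : ℝ, 0 < s →
      Integrable (fun w => ‖w.1 - Denoising.denoiser p s w.2‖ ^ 2) (Denoising.noisyPair p s) ∧
      Integrable (fun w => ‖w.1 - Denoising.denoiser q s w.2‖ ^ 2) (Denoising.noisyPair p s) ∧
      Denoising.mse p s (Denoising.denoiser p s) ≤ Denoising.mse p s (Denoising.denoiser q s)) ∧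
    -- time is the noise level: `σ_t = t`
    klDiv p q = ∫⁻ t in Ioi (0 : ℝ), ENNReal.ofReal
      ((Denoising.mse p t (Denoising.denoiser q t) - Denoising.mse p t (Denoising.denoiser p t))
        * t ^ (-3 : ℤ)) ∧
    -- a general noise schedule on `(0, T)`
    (∀ (T : EReal) (σ : ℝ → ℝ), 0 < T → Denoising.IsNoiseSchedule T σ →
      -- exact identity up to a time `S < T`
      (∀ S ∈ Denoising.times T,
        klDiv p q =
          klDiv (Denoising.noisyMarginal p (σ S)) (Denoising.noisyMarginal q (σ S)) +
          ∫⁻ t in Ioo 0 S, ENNReal.ofReal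
            (Denoising.excessError p q (σ t) * σ t ^ (-3 : ℤ) * deriv σ t)) ∧
      -- the noise becomes infinite at the horizon `T`
      (¬ BddAbove (σ '' Denoising.times T) →
        klDiv p q = ∫⁻ t in Denoising.times T, ENNReal.ofReal
          (Denoising.excessError p q (σ t) * σ t ^ (-3 : ℤ) * deriv σ t))) := by
  refine ⟨fun s hs => ⟨Denoising.integrable_sq_norm_sub_denoiser hp hp hs,
    Denoising.integrable_sq_norm_sub_denoiser hp hq hs,
    Denoising.mse_denoiser_self_le hp hq hs⟩, ?_, fun T σ _ hσ =>
    ⟨fun S hS => Denoising.klDiv_eq_add_setLIntegral hp hq hσ hS,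
      fun hunb => Denoising.klDiv_eq_setLIntegral_times hp hq hσ hunb⟩⟩
  have h := Denoising.klDiv_eq_setLIntegral_times hp hq Denoising.isNoiseSchedule_id (by
    rw [Denoising.times_top, image_id']
    exact not_bddAbove_Ioi 0)
  rw [Denoising.times_top] at h
  simpa only [Denoising.excessError, deriv_id'', mul_one] using h
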